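/- Let $a_1=c$ and $a_{i+1}=a_i^2+c$ for $i\ge 1$, viewed as polynomials in $\mathbb{Z}[c]$. For integers $m\ge 2$ and $n\ge 1$, let $\mu$ be the Möbius function and let $$G_{m,n}(c)=\prod_{k\mid n}\bigl(a_{m+k-1}+a_{m-1}\bigr)^{\mu(n/k)}\cdot\begin{cases}\prod_{k\mid n}a_k^{-\mu(n/k)} & \text{if } n\mid m-1,\\ 1 & \text{if } n\nmid m-1,\end{cases}$$ which is a monic polynomial in $\mathbb{Z}[c]$ (the $(m,n)$-Misiurewicz polynomial of the family $z^2+c$). Let $m,n\ge 2$ and assume that $G_{m,n}$ is irreducible over $\mathbb{Q}$. Let $c_0\in\mathbb{C}$ be a root of $G_{m,n}$, let $K=\mathbb{Q}(c_0)$, and let $\mathcal{O}_K$ be the ring of integers of $K$. Then: 1. $G_{m,1}(c_0)$ lies in $\mathcal{O}_K$ and is not a unit in $\mathcal{O}_K$. 2. If $n$ is even, then $G_{m,2}(c_0)$ lies in $\mathcal{O}_K$ and is not a unit in $\mathcal{O}_K$. -/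

import Mathlib

open Polynomial

/-- The critical orbit of `z ^ 2 + c`, as polynomials in the parameter `c = X`:
`a₀ = 0` and `aᵢ₊₁ = aᵢ ^ 2 + c`, so that `a₁ = c`. -/
noncomputable def critOrbit : ℕ → ℚ[X]
  | 0 => 0
  | i + 1 => critOrbit i ^ 2 + X

/-- The Möbius product that defines `G_{m,n}` (for `d = 2`, `ζ = -1`), as a rational function
of `c` over `ℚ`; the exponents `μ (n / k)` lie in `{-1, 0, 1}`. -/
noncomputable def misiurewiczRatFunc (m n : ℕ) : RatFunc ℚ :=
  (∏ k ∈ n.divisors,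
      algebraMap ℚ[X] (RatFunc ℚ) (critOrbit (m + k - 1) + critOrbit (m - 1)) ^
        (ArithmeticFunction.moebius (n / k))) *
    if n ∣ m - 1 then
      ∏ k ∈ n.divisors,
        algebraMap ℚ[X] (RatFunc ℚ) (critOrbit k) ^ (-ArithmeticFunction.moebius (n / k))
    else 1

/-- The `(m, n)`-Misiurewicz polynomial `G_{m,n}` of the family `z ^ 2 + c`, for `m ≥ 2`, `n ≥ 1`.
The Möbius product is in fact a polynomial in `c`, and `RatFunc.num` (the numerator of the reduced
fraction with monic denominator) is that polynomial. -/
noncomputable def misiurewicz (m n : ℕ) : ℚ[X] :=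
  (misiurewiczRatFunc m n).num

/-! Write `l = m - 1` and argue by contradiction for `g = 1` or `g = 2`. If `G_{m,g}(c₀)` is a unit,
its inverse is an integer polynomial in `c₀`. As `G_{m,n}` is monic and irreducible, `G_{m,g}` and
`G_{m,n}` then generate the unit ideal of `ℤ[X]`, so `G_{m,n}(c)` is a unit at every root `c` of
`G_{m,g}` (`isCoprime_of_isAlgUnit`, `isAlgUnit_of_isCoprime`).

At the parameters `c` that are used, `0` falls onto a cycle of length dividing `g`, with multiplier
`x`: `x = 2 a_m` for `g = 1`, `x = 4 (c + 1)` for `g = 2`. There the factors of `G_{m,n}` become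
geometric sums in `x`, up to units and factors that cancel, and their Möbius product is `Φ_{n/g}(x)`
(`isAlgUnit_cyclotomic_of_misiurewicz`). Hence `Φ_{n/g}(x)` is a unit, and so is `ζ - x` for a
primitive `n/g`-th root of unity `ζ`.

These multipliers are the nonzero roots of an explicit monic `P ∈ ℤ[X]`, so `P(ζ)` is a unit. But `P
≡ X ^ M (X - 2 ^ k)` modulo `2 ^ (k + 1)` with `k ≥ 2`, and such a `P` never takes a unit value at a
root of unity (`IsTwoAdicShift.mul_aeval_ne_one`). Indeed `u = P(ζ) ζ ^ (-M-1)` would be a unit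
congruent to `1` modulo `4`. Comparing `u` with its complex conjugate in all embeddings shows that
`u` is real, then that `ζ ^ 2 = ±1` and `u = 1`; the congruence modulo `2 ^ (k + 1)` finally makes
`ζ⁻¹` divisible by `2`. -/

/-! ### Polynomials congruent to `X ^ M (X - 2 ^ k)` modulo `2 ^ (k + 1)` -/

/-- `P` is monic of the form `X ^ M * (X - 2 ^ k)` modulo `2 ^ (k + 1)`. -/
def IsTwoAdicShift (k : ℕ) (P : ℤ[X]) : Prop :=
  ∃ (M : ℕ) (R : ℤ[X]), R.natDegree ≤ M ∧ P = X ^ M * (X - C (2 ^ k)) + C (2 ^ (k + 1)) * R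

namespace IsTwoAdicShift

theorem monic_natDegree {M k : ℕ} {R : ℤ[X]} (hR : R.natDegree ≤ M) :
    (X ^ M * (X - C (2 ^ k)) + C (2 ^ (k + 1)) * R).Monic ∧
    (X ^ M * (X - C (2 ^ k)) + C (2 ^ (k + 1)) * R).natDegree = M + 1 := by
  have h1 : (X ^ M * (X - C ((2 : ℤ) ^ k))).Monic := (monic_X_pow M).mul (monic_X_sub_C _)
  have h2 : (X ^ M * (X - C ((2 : ℤ) ^ k))).natDegree = M + 1 := by
    rw [(monic_X_pow M).natDegree_mul (monic_X_sub_C _), natDegree_X_pow, natDegree_X_sub_C]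
  have h3 : (C ((2 : ℤ) ^ (k + 1)) * R).degree < (X ^ M * (X - C ((2 : ℤ) ^ k))).degree := by
    rw [degree_eq_natDegree h1.ne_zero, h2]
    refine lt_of_le_of_lt degree_le_natDegree ?_
    have := natDegree_C_mul_le ((2 : ℤ) ^ (k + 1)) R
    exact_mod_cast (by omega : (C ((2 : ℤ) ^ (k + 1)) * R).natDegree < M + 1)
  exact ⟨h1.add_of_left h3, by rw [natDegree_add_eq_left_of_degree_lt h3, h2]⟩

theorem monic {k : ℕ} {P : ℤ[X]} (h : IsTwoAdicShift k P) : P.Monic := by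
  obtain ⟨M, R, hR, rfl⟩ := h
  exact (monic_natDegree hR).1

theorem natDegree_pos {k : ℕ} {P : ℤ[X]} (h : IsTwoAdicShift k P) : 0 < P.natDegree := by
  obtain ⟨M, R, hR, rfl⟩ := h
  rw [(monic_natDegree hR).2]; omega

theorem add {k e : ℕ} {P Q : ℤ[X]} (h : IsTwoAdicShift k P) (hQ : Q.natDegree < P.natDegree)
    (he : k + 1 ≤ e) : IsTwoAdicShift k (P + C (2 ^ e) * Q) := by
  obtain ⟨M, R, hR, rfl⟩ := h
  rw [(monic_natDegree hR).2] at hQ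
  refine ⟨M, R + C (2 ^ (e - (k + 1))) * Q, ?_, ?_⟩
  · refine (natDegree_add_le _ _).trans (max_le hR ?_)
    exact (natDegree_C_mul_le _ _).trans (by omega)
  · have : (C ((2 : ℤ) ^ e) : ℤ[X]) = C (2 ^ (k + 1)) * C (2 ^ (e - (k + 1))) := by
      rw [← C_mul, ← pow_add]; congr 2; omega
    rw [this]; ring

/-- In `(X - 2 ^ k) ^ 2 = X ^ 2 - 2 ^ (k + 1) X + 2 ^ (2k)` the last term vanishes modulo `2 ^ (k +
2)` exactly because `k ≥ 2`; the cross term with `R` gains a factor `2`. -/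
theorem sq {k : ℕ} {P : ℤ[X]} (h : IsTwoAdicShift k P) (hk : 2 ≤ k) :
    IsTwoAdicShift (k + 1) (P ^ 2) := by
  obtain ⟨M, R, hR, rfl⟩ := h
  obtain ⟨j, rfl⟩ := Nat.exists_eq_add_of_le' hk
  refine ⟨2 * M + 1, C (2 ^ j) * X ^ (2 * M) + X ^ M * (X - C (2 ^ (j + 2))) * R
    + C (2 ^ (j + 2)) * R ^ 2, ?_, ?_⟩
  · refine natDegree_add_le_of_degree_le (natDegree_add_le_of_degree_le ?_ ?_) ?_
    · exact (natDegree_C_mul_le _ _).trans (by simp)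
    · refine natDegree_mul_le_of_le (m := M + 1) (n := M) ?_ hR |>.trans (by omega)
      exact natDegree_mul_le_of_le (natDegree_X_pow_le M) (natDegree_X_sub_C _).le
    · refine (natDegree_C_mul_le _ _).trans (natDegree_pow_le.trans (by omega))
  · simp only [map_pow, map_ofNat]
    ring

theorem X_mul {k : ℕ} {P : ℤ[X]} (h : IsTwoAdicShift k P) : IsTwoAdicShift k (X * P) := by
  obtain ⟨M, R, hR, rfl⟩ := h
  refine ⟨M + 1, X * R, ?_, by ring⟩
  exact (natDegree_mul_le_of_le natDegree_X_le hR).trans (by omega)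

end IsTwoAdicShift

/-! ### Polynomials whose roots are the multipliers -/

/-- Rescaled critical orbit of the logistic map `w ↦ X * w * (1 - w)`. -/
noncomputable def logisticOrbit : ℕ → ℤ[X]
  | 0 => -1
  | i + 1 => X * (logisticOrbit i ^ 2 + C (2 ^ 2 ^ i) * logisticOrbit i)

theorem add_two_le_two_pow {i : ℕ} (hi : 2 ≤ i) : i + 2 ≤ 2 ^ i := by
  induction i, hi using Nat.le_induction with
  | base => norm_num
  | succ i hi ih => rw [pow_succ]; omega

theorem isTwoAdicShift_logisticOrbit {i : ℕ} (hi : 2 ≤ i) :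
    IsTwoAdicShift i (logisticOrbit i) := by
  induction i, hi using Nat.le_induction with
  | base =>
    refine ⟨2, 0, by simp, ?_⟩
    simp only [logisticOrbit]
    norm_num
    ring
  | succ i hi ih =>
    refine IsTwoAdicShift.X_mul (IsTwoAdicShift.add (ih.sq hi) ?_ (add_two_le_two_pow hi))
    rw [ih.monic.natDegree_pow]
    have := ih.natDegree_pos
    omega

/-- The equation on `logisticOrbit l` says that the critical orbit reaches `w = 1`, the other
preimage of the fixed point `w = 0`, whose multiplier is `x`. -/
theorem exists_isTwoAdicShift_logistic {l : ℕ} (hl : 1 ≤ l) :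
    ∃ k P, 2 ≤ k ∧ IsTwoAdicShift k P ∧
      ∀ x : ℂ, aeval x P = 0 → aeval x (logisticOrbit l) = -2 ^ 2 ^ l := by
  rcases hl.eq_or_lt with rfl | hl
  -- `logisticOrbit 1 = -X` is not monic, so `l = 1` is treated by hand: the equation is `x = 4`.
  · refine ⟨2, X - C (2 ^ 2), le_rfl, ⟨0, 0, by simp, by simp⟩, fun x hx => ?_⟩
    simp only [logisticOrbit, map_sub, map_add, map_mul, map_pow, map_neg, map_one, aeval_X, map_ofNat] at hx ⊢
    linear_combination -hx
  · have h := isTwoAdicShift_logisticOrbit hl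
    refine ⟨l, _, hl, h.add (Q := 1) (e := 2 ^ l) (by simpa using h.natDegree_pos)
      (by have := add_two_le_two_pow hl; omega), fun x hx => ?_⟩
    simp only [map_add, map_mul, map_pow, map_one, map_ofNat] at hx
    linear_combination hx

/-- The critical orbit in the parameter `X = 4 * (c + 1)`, rescaled to have integral
coefficients. -/
noncomputable def shiftedOrbit : ℕ → ℤ[X]
  | 0 => 0
  | i + 1 => shiftedOrbit i ^ 2 + C (2 ^ (2 ^ (i + 1) - 2)) * (X - C 4)

theorem isTwoAdicShift_shiftedOrbit {i : ℕ} (hi : 2 ≤ i) :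
    IsTwoAdicShift i (shiftedOrbit i) := by
  induction i, hi using Nat.le_induction with
  | base =>
    refine ⟨1, 0, by simp, ?_⟩
    simp only [shiftedOrbit]
    norm_num
    ring
  | succ i hi ih =>
    refine IsTwoAdicShift.add (ih.sq hi) ?_ ?_
    · rw [ih.monic.natDegree_pow, natDegree_X_sub_C]
      have := ih.natDegree_pos
      omega
    · have := add_two_le_two_pow hi
      rw [pow_succ]; omega

theorem natDegree_shiftedOrbit_lt {i : ℕ} (hi : 2 ≤ i) :
    (shiftedOrbit i).natDegree < (shiftedOrbit (i + 1)).natDegree := by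
  have h := isTwoAdicShift_shiftedOrbit hi
  have h1 := h.natDegree_pos
  rw [shiftedOrbit, natDegree_add_eq_left_of_natDegree_lt] <;> rw [h.monic.natDegree_pow]
  · omega
  · refine (natDegree_C_mul_le _ _).trans_lt ?_
    rw [natDegree_X_sub_C]; omega

/-- The equation is `1 + a_{l+1} - a_l = 0` multiplied by `2 ^ 2 ^ (l + 1)`, in the parameter `x = 4
(c + 1)`. -/
theorem exists_isTwoAdicShift_shifted {l : ℕ} (hl : 1 ≤ l) :
    ∃ k P, 2 ≤ k ∧ IsTwoAdicShift k P ∧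
      ∀ x : ℂ, aeval x P = 0 →
        2 ^ 2 ^ (l + 1) + aeval x (shiftedOrbit (l + 1))
          - 2 ^ 2 ^ l * aeval x (shiftedOrbit l) = 0 := by
  rcases hl.eq_or_lt with rfl | hl
  -- For `l = 1` the correction `2 ^ 2 ^ l = 4` is too large to be absorbed; it shifts `k` from `2`
  -- to `3`, the polynomial being `X ^ 2 - 8 X + 32`.
  · refine ⟨3, X * (X - C (2 ^ 3)) + C (2 ^ 4) * C 2, by norm_num, ⟨1, C 2, by simp, by simp⟩,
      fun x hx => ?_⟩
    simp only [shiftedOrbit, map_sub, map_add, map_mul, map_pow, map_zero, aeval_X, map_ofNat] at hx ⊢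
    norm_num at hx ⊢
    linear_combination hx
  · have h := isTwoAdicShift_shiftedOrbit (i := l + 1) (by omega)
    have h2 := add_two_le_two_pow hl
    refine ⟨l + 1, shiftedOrbit (l + 1) + C (2 ^ 2 ^ l) * (C (2 ^ 2 ^ l) - shiftedOrbit l),
      by omega, h.add ?_ h2, fun x hx => ?_⟩
    · refine (natDegree_sub_le _ _).trans_lt (max_lt ?_ (natDegree_shiftedOrbit_lt hl))
      rw [natDegree_C]; exact h.natDegree_pos
    · simp only [map_sub, map_add, map_mul, map_pow, map_ofNat] at hx
      rw [pow_succ 2 l, pow_mul]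
      linear_combination hx

/-! ### Units congruent to `1` modulo `4` and Kronecker's theorem -/

/-- If the inverse of `x` is integral over `ℤ`, then it is a polynomial in `x`. -/
theorem exists_aeval_mul_eq_one {F : Type*} [Field F] {x : F} (hx : x ≠ 0)
    (hi : IsIntegral ℤ x⁻¹) : ∃ h : ℤ[X], aeval x h * x = 1 := by
  obtain ⟨f, hf, hfx⟩ := hi
  refine ⟨-divX (reverse f), ?_⟩
  let := invertibleOfNonzero (inv_ne_zero hx)
  have h1 : aeval x (reverse f) = 0 := by
    have h2 := (eval₂_reverse_eq_zero_iff (algebraMap ℤ F) x⁻¹ f).2 hfx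
    rwa [invOf_eq_inv, inv_inv] at h2
  rw [← divX_mul_X_add (reverse f), coeff_zero_reverse, hf.leadingCoeff, map_add, map_mul,
    aeval_X, map_one, map_one] at h1
  rw [map_neg]
  linear_combination -h1

section NumberField

variable {K : Type*} [Field K]

theorem norm_embedding_eq_one {ζ : K} {n : ℕ} (hn : n ≠ 0) (hζ : ζ ^ n = 1) (φ : K →+* ℂ) :
    ‖φ ζ‖ = 1 :=
  Complex.norm_eq_one_of_pow_eq_one (by rw [← map_pow, hζ, map_one]) hn

theorem embedding_inv_eq_conj {ζ : K} {n : ℕ} (hn : n ≠ 0) (hζ : ζ ^ n = 1) (φ : K →+* ℂ) :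
    φ ζ⁻¹ = (starRingEnd ℂ) (φ ζ) := by
  rw [map_inv₀, Complex.inv_eq_conj (norm_embedding_eq_one hn hζ φ)]

theorem conj_aeval_embedding {ζ : K} {n : ℕ} (hn : n ≠ 0) (hζ : ζ ^ n = 1) (φ : K →+* ℂ)
    (Q : ℤ[X]) : φ (aeval ζ⁻¹ Q) = (starRingEnd ℂ) (φ (aeval ζ Q)) := by
  have h1 : ∀ z : K, φ (aeval z Q) = aeval (φ z) Q := fun z =>
    (aeval_algHom_apply φ.toIntAlgHom z Q).symm
  have h2 : ∀ z : ℂ, (starRingEnd ℂ) (aeval z Q) = aeval ((starRingEnd ℂ) z) Q := fun z =>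
    (aeval_algHom_apply (starRingEnd ℂ).toIntAlgHom z Q).symm
  rw [h1, h1, h2, embedding_inv_eq_conj hn hζ φ]

theorem isIntegral_intCast_div_imp [CharZero K] {a b : ℤ} (hb : b ≠ 0) (h : IsIntegral ℤ ((a : K) / b)) :
    b ∣ a := by
  have h' : IsIntegral ℤ ((a : ℚ) / b) := by
    have : algebraMap ℚ K ((a : ℚ) / b) = (a : K) / b := by simp
    rw [← this] at h
    exact (isIntegral_algebraMap_iff (algebraMap ℚ K).injective).1 h
  obtain ⟨c, hc⟩ := IsIntegrallyClosed.isIntegral_iff.1 h'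
  have hb' : (b : ℚ) ≠ 0 := by exact_mod_cast hb
  rw [eq_div_iff hb'] at hc
  refine ⟨c, ?_⟩
  have : ((c * b : ℤ) : ℚ) = a := by simpa using hc
  have : c * b = a := by exact_mod_cast this
  linarith

variable [NumberField K]

theorem eq_zero_of_forall_norm_embedding_lt_one {x : K} (hx : IsIntegral ℤ x)
    (h : ∀ φ : K →+* ℂ, ‖φ x‖ < 1) : x = 0 := by
  by_contra h0
  obtain ⟨n, hn, hxn⟩ :=
    NumberField.Embeddings.pow_eq_one_of_norm_le_one K ℂ h0 hx fun φ => (h φ).le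
  obtain ⟨φ⟩ : Nonempty (K →+* ℂ) := inferInstance
  exact (h φ).ne (norm_embedding_eq_one hn.ne' hxn φ)

theorem isIntegral_of_pow_eq_one {R : Type*} [CommRing R] {ζ : R} {n : ℕ} (hn : n ≠ 0)
    (hζ : ζ ^ n = 1) : IsIntegral ℤ ζ :=
  IsIntegral.of_pow (Nat.pos_of_ne_zero hn) (by rw [hζ]; exact isIntegral_one)

theorem isIntegral_aeval_int {R : Type*} [CommRing R] {x : R} (hx : IsIntegral ℤ x)
    (p : ℤ[X]) : IsIntegral ℤ (aeval x p) :=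
  adjoin_le_integralClosure hx (aeval_mem_adjoin_singleton ℤ x)

/-- Both `ζ` and `ζ⁻¹` satisfy `z ^ 2 = s`, so reduction modulo this quadratic gives the same
coefficients for both. -/
theorem exists_int_aeval_of_sq_eq {ζ : K} {s : ℤ} (hζ : ζ ^ 2 = s) (hs : s ^ 2 = 1) (Q : ℤ[X]) :
    ∃ a b : ℤ, aeval ζ Q = a + b * ζ ∧ aeval ζ⁻¹ Q = a + b * ζ⁻¹ := by
  have hss : (s : K) * s = 1 := by exact_mod_cast (by linarith [sq s] : s * s = 1)
  have h0 : ζ ≠ 0 := by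
    rintro rfl
    rw [← hζ] at hss; simp at hss
  have hinv : ζ⁻¹ * ζ⁻¹ = s := by
    have : ζ⁻¹ = s * ζ := by
      refine inv_eq_of_mul_eq_one_left ?_
      linear_combination (s : K) * hζ + hss
    rw [this]
    linear_combination (s : K) * s * hζ + (s : K) * hss
  induction Q using Polynomial.induction_on' with
  | add p q hp hq =>
    obtain ⟨a, b, h1, h2⟩ := hp
    obtain ⟨a', b', h3, h4⟩ := hq
    refine ⟨a + a', b + b', ?_, ?_⟩
    · rw [map_add, h1, h3]; push_cast; ring
    · rw [map_add, h2, h4]; push_cast; ring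
  | monomial m c =>
    simp only [aeval_monomial, eq_intCast]
    induction m with
    | zero => exact ⟨c, 0, by simp, by simp⟩
    | succ m ih =>
      obtain ⟨a, b, h1, h2⟩ := ih
      refine ⟨b * s, a, ?_, ?_⟩
      · rw [pow_succ, ← mul_assoc, h1]; push_cast; linear_combination (b : K) * hζ
      · rw [pow_succ, ← mul_assoc, h2]; push_cast; linear_combination (b : K) * hinv

/-- Below, `x` is the unit `P(ζ) ζ ^ (-M-1)`, written as an integral polynomial in `ζ`, and `y` is
its complex conjugate in every embedding. -/
theorem IsTwoAdicShift.mul_aeval_ne_one {k : ℕ} {P : ℤ[X]} (hP : IsTwoAdicShift k P) (hk : 2 ≤ k)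
    {ζ : K} {n : ℕ} (hn : n ≠ 0) (hζ : ζ ^ n = 1) {v : K} (hv : IsIntegral ℤ v) :
    v * aeval ζ P ≠ 1 := by
  intro hvP
  obtain ⟨M, R, hR, rfl⟩ := hP
  have hζ0 : ζ ≠ 0 := by rintro rfl; simp [hn] at hζ
  have hζi : IsIntegral ℤ ζ := isIntegral_of_pow_eq_one hn hζ
  have hζi' : IsIntegral ℤ ζ⁻¹ := isIntegral_of_pow_eq_one hn (by rw [inv_pow, hζ, inv_one])
  have hinvpow : ∀ {z : K}, z ^ n = 1 → z ^ (n - 1) = z⁻¹ := by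
    intro z hz
    refine eq_inv_of_mul_eq_one_left ?_
    rw [← pow_succ, Nat.sub_add_cancel (Nat.pos_of_ne_zero hn), hz]
  -- `u = P(ζ) ζ ^ (-M-1)` as the value of an integral polynomial
  set Q : ℤ[X] := X ^ ((n - 1) * (M + 1)) * (X ^ M * (X - C (2 ^ k)) + C (2 ^ (k + 1)) * R)
    with hQ
  have hval : ∀ {z : K}, z ≠ 0 → z ^ n = 1 → aeval z Q =
      1 - 2 ^ k * z⁻¹ + 2 ^ (k + 1) * (z⁻¹ ^ (M + 1) * aeval z R) := by
    intro z hz0 hz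
    simp only [hQ, map_mul, map_add, map_sub, map_pow, aeval_X, map_ofNat, pow_mul,
      hinvpow hz]
    have h1 : z⁻¹ * z = 1 := inv_mul_cancel₀ hz0
    have h2 : z⁻¹ ^ M * z ^ M = 1 := by rw [← mul_pow, h1, one_pow]
    linear_combination (1 - 2 ^ k * z⁻¹) * h2 + z⁻¹ ^ M * z ^ M * h1
  have hx := hval hζ0 hζ
  have hy := hval (inv_ne_zero hζ0) (by rw [inv_pow, hζ, inv_one])
  rw [inv_inv] at hy
  set x := aeval ζ Q with hxdef
  set y := aeval ζ⁻¹ Q with hydef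
  have hxy : ∀ φ : K →+* ℂ, φ y = (starRingEnd ℂ) (φ x) := fun φ =>
    conj_aeval_embedding hn hζ φ Q
  -- the inverse of `x`
  obtain ⟨x', hx'i, hx'⟩ : ∃ x' : K, IsIntegral ℤ x' ∧ x' * x = 1 := by
    refine ⟨v * ζ ^ (M + 1), hv.mul (hζi.pow _), ?_⟩
    have : x = ζ⁻¹ ^ (M + 1) *
        aeval ζ (X ^ M * (X - C (2 ^ k)) + C (2 ^ (k + 1)) * R : ℤ[X]) := by
      rw [hxdef, hQ, map_mul, map_pow, aeval_X, pow_mul, hinvpow hζ]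
    rw [this]
    linear_combination (ζ ^ (M + 1) * ζ⁻¹ ^ (M + 1)) * hvP +
      (by rw [← mul_pow, mul_inv_cancel₀ hζ0, one_pow] : ζ ^ (M + 1) * ζ⁻¹ ^ (M + 1) = 1)
  have hRζ : IsIntegral ℤ (ζ⁻¹ ^ (M + 1) * aeval ζ R) :=
    (hζi'.pow _).mul (isIntegral_aeval_int hζi R)
  have hRζ' : IsIntegral ℤ (ζ ^ (M + 1) * aeval ζ⁻¹ R) :=
    (hζi.pow _).mul (isIntegral_aeval_int hζi' R)
  set t := ζ⁻¹ ^ (M + 1) * aeval ζ R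
  set t' := ζ ^ (M + 1) * aeval ζ⁻¹ R
  -- The integral polynomial that gives `x⁻¹` from `x` also gives `y⁻¹` from `y`, by conjugating in
  -- one embedding.
  obtain ⟨y', hy'i, hy'⟩ : ∃ y' : K, IsIntegral ℤ y' ∧ y' * y = 1 := by
    have hx0 : x ≠ 0 := right_ne_zero_of_mul_eq_one hx'
    obtain ⟨h, hh⟩ := exists_aeval_mul_eq_one hx0 (by rwa [← eq_inv_of_mul_eq_one_left hx'])
    refine ⟨aeval y h, isIntegral_aeval_int (isIntegral_aeval_int hζi' Q) h, ?_⟩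
    obtain ⟨φ⟩ : Nonempty (K →+* ℂ) := inferInstance
    apply φ.injective
    have h1 : ∀ z : K, aeval (aeval z Q) h * aeval z Q = aeval z (h.comp Q * Q) := fun z => by
      rw [map_mul (aeval z) (h.comp Q), aeval_comp]
    rw [hydef, h1, conj_aeval_embedding hn hζ φ, ← h1, ← hxdef, hh, map_one, map_one]
  have h2 : (2 : K) ≠ 0 := two_ne_zero
  have hInt : ∀ a : ℕ, IsIntegral ℤ ((2 : K) ^ a) := fun a => by
    have := isIntegral_algebraMap (R := ℤ) (A := K) (x := 2 ^ a)
    simpa using this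
  obtain ⟨j, rfl⟩ := Nat.exists_eq_add_of_le' hk
  -- `x = y`
  have hxy_eq : x = y := by
    -- The algebraic integer `τ = (x - y) / (4 y)` has absolute value at most `1/2` in every
    -- embedding, since `|x| = |y|` there. So it is zero.
    have hτ : IsIntegral ℤ ((2 ^ j * (ζ - ζ⁻¹) + 2 ^ (j + 1) * (t - t')) * y') :=
      ((((hInt j).mul (hζi.sub hζi')).add ((hInt _).mul (hRζ.sub hRζ'))).mul hy'i)
    have hτe : 4 * ((2 ^ j * (ζ - ζ⁻¹) + 2 ^ (j + 1) * (t - t')) * y') = (x - y) * y' := by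
      rw [hx, hy]; ring
    have h0 := eq_zero_of_forall_norm_embedding_lt_one hτ fun φ => by
      have e1 := congrArg (fun z => ‖φ z‖) hτe
      have e2 := congrArg (fun z => ‖φ z‖) hy'
      simp only [map_mul, norm_mul, map_sub, map_ofNat, map_one, norm_one] at e1 e2 ⊢
      rw [Complex.norm_ofNat] at e1
      have e3 : ‖φ x - φ y‖ ≤ 2 * ‖φ y‖ := by
        refine (norm_sub_le _ _).trans ?_
        have : ‖φ x‖ = ‖φ y‖ := by rw [hxy φ, RCLike.norm_conj]
        linarith
      nlinarith [norm_nonneg (φ y'), mul_le_mul_of_nonneg_right e3 (norm_nonneg (φ y'))]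
    rw [h0, mul_zero] at hτe
    have hy'0 : y' ≠ 0 := left_ne_zero_of_mul_eq_one hy'
    exact sub_eq_zero.1 ((mul_eq_zero.1 hτe.symm).resolve_right hy'0)
  -- `ζ ^ 2 = ± 1`
  have hζ2 : ∃ s : ℤ, ζ ^ 2 = s ∧ s ^ 2 = 1 := by
    have hd : ζ - ζ⁻¹ = 2 * (t' - t) := by
      have h4 : (2 : K) ^ (j + 2) ≠ 0 := pow_ne_zero _ h2
      apply mul_left_cancel₀ h4
      linear_combination hxy_eq - hx + hy
    -- As `|ζ - ζ⁻¹| ≤ 2`, the algebraic integer `t' - t` has absolute value at most `1` everywhere: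
    -- it is zero, so `ζ ^ 2 = 1`, or a root of unity, so `|Im φ(ζ)| = 1` and `ζ ^ 2 = -1`.
    by_cases ht : t' - t = 0
    · refine ⟨1, ?_, by norm_num⟩
      rw [ht, mul_zero, sub_eq_zero] at hd
      rw [pow_two]; nth_rewrite 2 [hd]; simp [hζ0]
    · have hle : ∀ φ : K →+* ℂ, ‖φ (t' - t)‖ ≤ 1 := fun φ => by
        have e1 := congrArg (fun z => ‖φ z‖) hd
        simp only [map_mul, norm_mul, map_ofNat, Complex.norm_ofNat] at e1
        have e2 : ‖φ (ζ - ζ⁻¹)‖ ≤ 1 + 1 := by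
          rw [map_sub]
          refine (norm_sub_le _ _).trans (le_of_eq ?_)
          rw [map_inv₀, norm_inv, norm_embedding_eq_one hn hζ φ, inv_one]
        linarith
      obtain ⟨r, hr, htr⟩ :=
        NumberField.Embeddings.pow_eq_one_of_norm_le_one K ℂ ht (hRζ'.sub hRζ) hle
      obtain ⟨φ⟩ : Nonempty (K →+* ℂ) := inferInstance
      refine ⟨-1, φ.injective ?_, by norm_num⟩
      have e1 := congrArg (fun z => ‖φ z‖) hd
      simp only [map_mul, norm_mul, map_ofNat, Complex.norm_ofNat,
        norm_embedding_eq_one hr.ne' htr φ, map_sub φ ζ, embedding_inv_eq_conj hn hζ φ] at e1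
      have e2 := norm_embedding_eq_one hn hζ φ
      rw [Complex.sub_conj] at e1
      have e3 : (φ ζ).im ^ 2 = 1 := by
        simp at e1
        rw [← sq_abs, e1, one_pow]
      have e4 : (φ ζ).re ^ 2 + (φ ζ).im ^ 2 = 1 := by
        have := Complex.sq_norm (φ ζ)
        rw [e2, Complex.normSq_apply] at this
        linarith
      have e5 : (φ ζ).re = 0 := by
        have : (φ ζ).re ^ 2 = 0 := by linarith
        exact pow_eq_zero_iff two_ne_zero |>.1 this
      rw [map_pow]
      apply Complex.ext
      · simp [pow_two, e5]; linarith [pow_two (φ ζ).im]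
      · simp [pow_two, e5]
  -- `x` is a rational integer
  have hxint : ∃ a : ℤ, x = a := by
    obtain ⟨s, hs, hs1⟩ := hζ2
    obtain ⟨a, b, ha, hb⟩ := exists_int_aeval_of_sq_eq hs hs1 Q
    rcases sq_eq_one_iff.1 hs1 with rfl | rfl
    · rcases sq_eq_one_iff.1 (by simpa using hs : ζ ^ 2 = 1) with h | h
      · exact ⟨a + b, by rw [hxdef, ha, h]; push_cast; ring⟩
      · exact ⟨a - b, by rw [hxdef, ha, h]; push_cast; ring⟩
    · have hinv : ζ⁻¹ = -ζ := by
        refine inv_eq_of_mul_eq_one_left ?_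
        push_cast at hs
        linear_combination -hs
      have hb0 : (b : K) * ζ = 0 := by
        have : (2 : K) * (b * ζ) = 0 := by
          rw [hydef, hb, hxdef, ha, hinv] at hxy_eq
          linear_combination hxy_eq
        exact (mul_eq_zero.1 this).resolve_left h2
      exact ⟨a, by rw [hxdef, ha, hb0, add_zero]⟩
  obtain ⟨a, ha⟩ := hxint
  have ha1 : IsIntegral ℤ (((1 : ℤ) : K) / a) := by
    rw [← ha, Int.cast_one, one_div, ← eq_inv_of_mul_eq_one_left hx']
    exact hx'i
  have ha0 : a ≠ 0 := by
    rintro rfl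
    rw [ha] at hx'; simp at hx'
  have hau := Int.isUnit_iff.1 (isUnit_of_dvd_one (isIntegral_intCast_div_imp ha0 ha1))
  -- `k ≥ 2` gives `x ≡ 1` modulo `4`, which excludes `-1`.
  have h4 : (4 : ℤ) ∣ a - 1 := by
    refine isIntegral_intCast_div_imp (K := K) (by norm_num) ?_
    have : (((a - 1 : ℤ) : K) / (4 : ℤ)) = -2 ^ j * ζ⁻¹ + 2 ^ (j + 1) * t := by
      push_cast
      rw [← ha, hx, div_eq_iff (by norm_num)]
      ring
    rw [this]
    exact ((hInt j).neg.mul hζi').add ((hInt _).mul hRζ)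
  have ha' : a = 1 := by
    rcases hau with h | h
    · exact h
    · rw [h] at h4; norm_num at h4
  have h1 : ζ⁻¹ = 2 * t := by
    have h4 : (2 : K) ^ (j + 2) ≠ 0 := pow_ne_zero _ h2
    apply mul_left_cancel₀ h4
    rw [ha', Int.cast_one] at ha
    linear_combination hx - ha
  have h2' : IsIntegral ℤ (((1 : ℤ) : K) / (2 : ℤ)) := by
    have : (((1 : ℤ) : K) / (2 : ℤ)) = t * ζ := by
      push_cast
      rw [div_eq_iff h2]
      linear_combination ζ * h1 - mul_inv_cancel₀ hζ0
    rw [this]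
    exact hRζ.mul hζi
  exact absurd (isIntegral_intCast_div_imp (by norm_num) h2') (by norm_num)

end NumberField

/-! ### Units among the complex algebraic integers -/

/-- `x` is a unit in the ring of algebraic integers. -/
def IsAlgUnit (x : ℂ) : Prop := x ≠ 0 ∧ IsIntegral ℤ x ∧ IsIntegral ℤ x⁻¹

namespace IsAlgUnit

theorem one : IsAlgUnit 1 := ⟨one_ne_zero, isIntegral_one, by simpa using isIntegral_one⟩

theorem mul {x y : ℂ} (hx : IsAlgUnit x) (hy : IsAlgUnit y) : IsAlgUnit (x * y) :=
  ⟨mul_ne_zero hx.1 hy.1, hx.2.1.mul hy.2.1, by rw [mul_inv]; exact hx.2.2.mul hy.2.2⟩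

theorem inv {x : ℂ} (hx : IsAlgUnit x) : IsAlgUnit x⁻¹ :=
  ⟨inv_ne_zero hx.1, hx.2.2, by rw [inv_inv]; exact hx.2.1⟩

theorem pow {x : ℂ} (hx : IsAlgUnit x) (k : ℕ) : IsAlgUnit (x ^ k) := by
  induction k with
  | zero => simpa using one
  | succ k ih => rw [pow_succ]; exact ih.mul hx

theorem zpow {x : ℂ} (hx : IsAlgUnit x) (k : ℤ) : IsAlgUnit (x ^ k) := by
  rcases k with k | k
  · simpa using hx.pow k
  · simpa using (hx.pow (k + 1)).inv

theorem prod {ι : Type*} {s : Finset ι} {f : ι → ℂ} (h : ∀ i ∈ s, IsAlgUnit (f i)) :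
    IsAlgUnit (∏ i ∈ s, f i) :=
  Finset.prod_induction f IsAlgUnit (fun _ _ => mul) one h

theorem of_mul {x y : ℂ} (hx : IsIntegral ℤ x) (hy : IsIntegral ℤ y) (h : IsAlgUnit (x * y)) :
    IsAlgUnit x := by
  have hx0 := left_ne_zero_of_mul h.1
  have hy0 := right_ne_zero_of_mul h.1
  refine ⟨hx0, hx, ?_⟩
  have : x⁻¹ = y * (x * y)⁻¹ := by field_simp
  rw [this]
  exact hy.mul h.2.2

theorem of_prod {ι : Type*} {s : Finset ι} {f : ι → ℂ} (hf : ∀ i ∈ s, IsIntegral ℤ (f i))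
    (h : IsAlgUnit (∏ i ∈ s, f i)) {i : ι} (hi : i ∈ s) : IsAlgUnit (f i) := by
  classical
  rw [← Finset.mul_prod_erase s f hi] at h
  exact of_mul (hf i hi) (IsIntegral.prod _ fun j hj => hf j (Finset.mem_of_mem_erase hj)) h

theorem of_isUnit {x : integralClosure ℤ ℂ} (hx : IsUnit x) : IsAlgUnit x := by
  obtain ⟨y, hy⟩ := hx.exists_right_inv
  have hy' : (x : ℂ) * y = 1 := by exact_mod_cast congrArg Subtype.val hy
  exact of_mul x.2 y.2 (by rw [hy']; exact one)

theorem of_root_of_unity {x : ℂ} {n : ℕ} (hn : n ≠ 0) (hx : x ^ n = 1) : IsAlgUnit x := by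
  refine ⟨?_, isIntegral_of_pow_eq_one hn hx,
    isIntegral_of_pow_eq_one hn (by rw [inv_pow, hx, inv_one])⟩
  rintro rfl
  simp [hn] at hx

/-- If `Φ_n(x)` is a unit, then so is `ζ - x` for every primitive `n`-th root of unity `ζ`. -/
theorem sub_of_cyclotomic {n : ℕ} {ζ x : ℂ} (hn : 0 < n) (hζ : IsPrimitiveRoot ζ n)
    (hx : IsIntegral ℤ x) (h : IsAlgUnit (eval x (cyclotomic n ℂ))) : IsAlgUnit (ζ - x) := by
  rw [cyclotomic_eq_prod_X_sub_primitiveRoots hζ, eval_prod] at h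
  have h1 := of_prod (fun μ hμ => ?_) h ((mem_primitiveRoots hn).2 hζ)
  · rw [eval_sub, eval_X, eval_C] at h1
    have := h1.mul (of_root_of_unity (x := -1) two_ne_zero (by norm_num))
    simpa using this
  · rw [eval_sub, eval_X, eval_C]
    exact hx.sub (isIntegral_of_pow_eq_one hn.ne' ((mem_primitiveRoots hn).1 hμ).pow_eq_one)

end IsAlgUnit

theorem IsTwoAdicShift.not_isAlgUnit {k : ℕ} {P : ℤ[X]} (hP : IsTwoAdicShift k P) (hk : 2 ≤ k)
    {ζ : ℂ} {n : ℕ} (hn : n ≠ 0) (hζ : ζ ^ n = 1) : ¬ IsAlgUnit (aeval ζ P) := by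
  intro h
  have hζi : IsIntegral ℚ ζ := (isIntegral_of_pow_eq_one hn hζ).tower_top
  have := IntermediateField.adjoin.finiteDimensional hζi
  let K := IntermediateField.adjoin ℚ {ζ}
  have : NumberField K := { }
  set g : K := IntermediateField.AdjoinSimple.gen ℚ ζ
  have hg : (g : ℂ) = ζ := IntermediateField.AdjoinSimple.coe_gen ℚ ζ
  have hgP : ((aeval g P : K) : ℂ) = aeval ζ P := by
    rw [← hg]; exact (aeval_algebraMap_apply ℂ g P).symm
  refine hP.mul_aeval_ne_one (K := K) hk (ζ := g) hn (by apply Subtype.ext; simpa [hg] using hζ)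
    (v := (aeval g P)⁻¹) ?_ ?_
  · refine (isIntegral_algebraMap_iff (algebraMap K ℂ).injective).1 ?_
    rw [map_inv₀]
    change IsIntegral ℤ ((aeval g P : K) : ℂ)⁻¹
    rw [hgP]
    exact h.2.2
  · refine inv_mul_cancel₀ fun h0 => h.1 ?_
    rw [← hgP, h0]; rfl

/-- If all roots of `P` have unit difference with `ζ`, then `P(ζ)` is a unit. -/
theorem isAlgUnit_aeval_of_roots {P : ℤ[X]} (hP : P.Monic) {ζ : ℂ}
    (h : ∀ x : ℂ, aeval x P = 0 → IsAlgUnit (ζ - x)) : IsAlgUnit (aeval ζ P) := by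
  have hm : (P.map (algebraMap ℤ ℂ)).Monic := hP.map _
  have hs := IsAlgClosed.splits (P.map (algebraMap ℤ ℂ))
  rw [← eval_map_algebraMap, hs.eq_prod_roots_of_monic hm, eval_multiset_prod, Multiset.map_map]
  refine Multiset.prod_induction IsAlgUnit _ (fun _ _ => IsAlgUnit.mul) IsAlgUnit.one ?_
  intro y hy
  obtain ⟨x, hx, rfl⟩ := Multiset.mem_map.1 hy
  have := (mem_roots hm.ne_zero).1 hx
  rw [IsRoot, eval_map_algebraMap] at this
  simpa using h x this

/-- If `p(c)` is a unit at a root `c` of the irreducible polynomial `q`, then `p` and `q` generate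
the unit ideal of `ℤ[X]`. -/
theorem isCoprime_of_isAlgUnit {p q : ℤ[X]} (hq : q.Monic)
    (hirr : Irreducible (q.map (algebraMap ℤ ℚ))) {c : ℂ} (hc : aeval c q = 0)
    (h : IsAlgUnit (aeval c p)) : IsCoprime p q := by
  obtain ⟨f, hf⟩ := exists_aeval_mul_eq_one h.1 h.2.2
  have hdvd : q ∣ f.comp p * p - 1 := by
    -- Divisibility by the monic `q` may be tested over `ℚ`, where `q` is the minimal polynomial of
    -- `c`.
    rw [← map_dvd_map (algebraMap ℤ ℚ) (RingHom.injective_int _) hq]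
    have h0 : aeval c (q.map (algebraMap ℤ ℚ)) = 0 := by rwa [aeval_map_algebraMap]
    have h1 := minpoly.eq_of_irreducible_of_monic hirr h0 (hq.map _)
    rw [h1]
    refine minpoly.dvd _ _ ?_
    rw [aeval_map_algebraMap, map_sub, map_mul, aeval_comp, hf, map_one, sub_self]
  obtain ⟨g, hg⟩ := hdvd
  exact ⟨f.comp p, -g, by linear_combination hg⟩

theorem isAlgUnit_of_isCoprime {p q : ℤ[X]} (h : IsCoprime p q) {c : ℂ} (hc : IsIntegral ℤ c)
    (hp : aeval c p = 0) : IsAlgUnit (aeval c q) := by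
  obtain ⟨a, b, hab⟩ := h
  have := congrArg (aeval c) hab
  rw [map_add, map_mul, map_mul, hp, mul_zero, zero_add, map_one] at this
  exact .of_mul (isIntegral_aeval_int hc q) (isIntegral_aeval_int hc b)
    (by rw [mul_comm, this]; exact .one)

/-! ### Integrality and values of rational functions -/

/-- A quotient of monic polynomials with integer coefficients. -/
def IsMonicIntRatio (r : RatFunc ℚ) : Prop :=
  ∃ p q : ℤ[X], p.Monic ∧ q.Monic ∧
    r = algebraMap ℚ[X] (RatFunc ℚ) (p.map (algebraMap ℤ ℚ)) /
      algebraMap ℚ[X] (RatFunc ℚ) (q.map (algebraMap ℤ ℚ))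

namespace IsMonicIntRatio

theorem of_monic {p : ℤ[X]} (hp : p.Monic) :
    IsMonicIntRatio (algebraMap ℚ[X] (RatFunc ℚ) (p.map (algebraMap ℤ ℚ))) :=
  ⟨p, 1, hp, monic_one, by simp⟩

theorem one : IsMonicIntRatio 1 := ⟨1, 1, monic_one, monic_one, by simp⟩

theorem mul {r s : RatFunc ℚ} (hr : IsMonicIntRatio r) (hs : IsMonicIntRatio s) :
    IsMonicIntRatio (r * s) := by
  obtain ⟨p, q, hp, hq, rfl⟩ := hr
  obtain ⟨p', q', hp', hq', rfl⟩ := hs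
  exact ⟨p * p', q * q', hp.mul hp', hq.mul hq', by
    rw [Polynomial.map_mul, Polynomial.map_mul, map_mul, map_mul, div_mul_div_comm]⟩

theorem inv {r : RatFunc ℚ} (hr : IsMonicIntRatio r) : IsMonicIntRatio r⁻¹ := by
  obtain ⟨p, q, hp, hq, rfl⟩ := hr
  exact ⟨q, p, hq, hp, inv_div _ _⟩

theorem pow {r : RatFunc ℚ} (hr : IsMonicIntRatio r) (k : ℕ) : IsMonicIntRatio (r ^ k) := by
  induction k with
  | zero => simpa using one
  | succ k ih => rw [pow_succ]; exact ih.mul hr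

theorem zpow {r : RatFunc ℚ} (hr : IsMonicIntRatio r) (k : ℤ) : IsMonicIntRatio (r ^ k) := by
  rcases k with k | k
  · simpa using hr.pow k
  · simpa using (hr.pow (k + 1)).inv

theorem prod {ι : Type*} {s : Finset ι} {f : ι → RatFunc ℚ}
    (h : ∀ i ∈ s, IsMonicIntRatio (f i)) : IsMonicIntRatio (∏ i ∈ s, f i) :=
  Finset.prod_induction f IsMonicIntRatio (fun _ _ => mul) one h

/-- Gauss's lemma. It makes numerator and denominator integral without showing that the Möbius
product is a polynomial. -/
theorem exists_map_eq_of_dvd {p : ℤ[X]} (hp : p.Monic) {g : ℚ[X]} (hg : g.Monic)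
    (h : g ∣ p.map (algebraMap ℤ ℚ)) : ∃ g' : ℤ[X], g'.Monic ∧ g'.map (algebraMap ℤ ℚ) = g := by
  obtain ⟨g', hg'⟩ := IsIntegrallyClosed.eq_map_mul_C_of_dvd ℚ hp h
  rw [hg.leadingCoeff, C_1, mul_one] at hg'
  refine ⟨g', ?_, hg'⟩
  exact monic_of_injective (RingHom.injective_int (algebraMap ℤ ℚ)) (by rwa [hg'])

theorem exists_num {r : RatFunc ℚ} (hr : IsMonicIntRatio r) :
    ∃ p : ℤ[X], p.Monic ∧ p.map (algebraMap ℤ ℚ) = r.num := by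
  obtain ⟨p, q, hp, hq, h⟩ := hr
  have hp' := hp.map (algebraMap ℤ ℚ)
  have hq' := hq.map (algebraMap ℤ ℚ)
  have h1 := (RatFunc.num_mul_eq_mul_denom_iff hq'.ne_zero).2 h
  refine exists_map_eq_of_dvd hp ?_ ((RatFunc.num_dvd hp'.ne_zero).2 ⟨_, hq'.ne_zero, h⟩)
  exact hq'.of_mul_monic_right (by rw [h1]; exact hp'.mul (RatFunc.monic_denom r))

theorem exists_denom {r : RatFunc ℚ} (hr : IsMonicIntRatio r) :
    ∃ p : ℤ[X], p.Monic ∧ p.map (algebraMap ℤ ℚ) = r.denom := by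
  obtain ⟨p, q, hp, hq, h⟩ := hr
  exact exists_map_eq_of_dvd hq (RatFunc.monic_denom r)
    ((RatFunc.denom_dvd (hq.map (algebraMap ℤ ℚ)).ne_zero).2 ⟨_, h⟩)

end IsMonicIntRatio

/-- The rational function `r` is defined at `c` with value `v`. -/
def HasValueAt (c : ℂ) (r : RatFunc ℚ) (v : ℂ) : Prop :=
  ∃ p q : ℚ[X], r = algebraMap ℚ[X] (RatFunc ℚ) p / algebraMap ℚ[X] (RatFunc ℚ) q ∧
    aeval c q ≠ 0 ∧ aeval c p = v * aeval c q

namespace HasValueAt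

variable {c : ℂ}

theorem of_poly (p : ℚ[X]) : HasValueAt c (algebraMap ℚ[X] (RatFunc ℚ) p) (aeval c p) :=
  ⟨p, 1, by simp, by simp, by simp⟩

theorem one : HasValueAt c 1 1 := ⟨1, 1, by simp, by simp, by simp⟩

theorem mul {r s : RatFunc ℚ} {v w : ℂ} (hr : HasValueAt c r v) (hs : HasValueAt c s w) :
    HasValueAt c (r * s) (v * w) := by
  obtain ⟨p, q, rfl, h0, h⟩ := hr
  obtain ⟨p', q', rfl, h0', h'⟩ := hs
  refine ⟨p * p', q * q', by rw [map_mul, map_mul, div_mul_div_comm], ?_, ?_⟩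
  · rw [map_mul]; exact mul_ne_zero h0 h0'
  · rw [map_mul, map_mul, h, h']; ring

theorem inv {r : RatFunc ℚ} {v : ℂ} (hr : HasValueAt c r v) (hv : v ≠ 0) :
    HasValueAt c r⁻¹ v⁻¹ := by
  obtain ⟨p, q, rfl, h0, h⟩ := hr
  refine ⟨q, p, inv_div _ _, ?_, ?_⟩
  · rw [h]; exact mul_ne_zero hv h0
  · rw [h, inv_mul_cancel_left₀ hv]

theorem pow {r : RatFunc ℚ} {v : ℂ} (hr : HasValueAt c r v) (k : ℕ) :
    HasValueAt c (r ^ k) (v ^ k) := by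
  induction k with
  | zero => simpa using one
  | succ k ih => rw [pow_succ, pow_succ]; exact ih.mul hr

theorem zpow {r : RatFunc ℚ} {v : ℂ} (hr : HasValueAt c r v) (hv : v ≠ 0) (k : ℤ) :
    HasValueAt c (r ^ k) (v ^ k) := by
  rcases k with k | k
  · simpa using hr.pow k
  · simpa using (hr.pow (k + 1)).inv (pow_ne_zero _ hv)

theorem prod {ι : Type*} {s : Finset ι} {f : ι → RatFunc ℚ} {g : ι → ℂ}
    (h : ∀ i ∈ s, HasValueAt c (f i) (g i)) : HasValueAt c (∏ i ∈ s, f i) (∏ i ∈ s, g i) := by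
  classical
  induction s using Finset.induction_on with
  | empty => simpa using one
  | insert a s ha ih =>
    rw [Finset.prod_insert ha, Finset.prod_insert ha]
    exact (h a (Finset.mem_insert_self a s)).mul
      (ih fun i hi => h i (Finset.mem_insert_of_mem hi))

theorem aeval_num {r : RatFunc ℚ} {v : ℂ} (hr : HasValueAt c r v) :
    aeval c r.num = v * aeval c r.denom := by
  obtain ⟨p, q, h, h0, h1⟩ := hr
  have hq : q ≠ 0 := by rintro rfl; simp at h0
  have h2 := congrArg (aeval c) ((RatFunc.num_mul_eq_mul_denom_iff hq).2 h)
  rw [map_mul, map_mul, h1] at h2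
  apply mul_right_cancel₀ h0
  linear_combination h2

end HasValueAt

/-! ### The critical orbit over a commutative ring, and its cofactors -/

section Orbit

variable {R : Type*} [CommRing R]

/-- The orbit of `0` under `z ↦ z ^ 2 + c`. -/
def zeroOrbit (c : R) : ℕ → R
  | 0 => 0
  | i + 1 => zeroOrbit c i ^ 2 + c

/-- The cofactor of `c` in `zeroOrbit c k`. -/
def orbitQuotOne (c : R) : ℕ → R
  | 0 => 0
  | k + 1 => c * orbitQuotOne c k ^ 2 + 1

/-- The cofactor of `zeroOrbit c 2` in `zeroOrbit c (2 * j)`. -/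
def orbitQuotTwo (c : R) : ℕ → R
  | 0 => 0
  | j + 1 => 1 + orbitQuotTwo c j ^ 2 * zeroOrbit c 2 * (zeroOrbit c (2 * j) ^ 2 + 2 * c)

/-- The cofactor of `a_{l+1} + a_l` in `a_{l+k} + a_l`. -/
def sumQuotOne (c : R) (l : ℕ) : ℕ → R
  | 0 => 0
  | k + 1 => 1 + sumQuotOne c l k * (zeroOrbit c (l + k) - zeroOrbit c l)

/-- The cofactor of `a_{l+2} + a_l` in `a_{l+2j} + a_l`. -/
def sumQuotTwo (c : R) (l : ℕ) : ℕ → R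
  | 0 => 0
  | j + 1 => 1 + sumQuotTwo c l j * ((zeroOrbit c (l + 2 * j) - zeroOrbit c l) *
      (zeroOrbit c (l + 2 * j + 1) + zeroOrbit c (l + 1)))

theorem zeroOrbit_succ (c : R) (i : ℕ) : zeroOrbit c (i + 1) = zeroOrbit c i ^ 2 + c := rfl

theorem zeroOrbit_eq_mul (c : R) (k : ℕ) : zeroOrbit c k = c * orbitQuotOne c k := by
  induction k with
  | zero => simp [zeroOrbit, orbitQuotOne]
  | succ k ih => rw [zeroOrbit, orbitQuotOne, ih]; ring

theorem zeroOrbit_two_mul (c : R) (j : ℕ) :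
    zeroOrbit c (2 * j) = zeroOrbit c 2 * orbitQuotTwo c j := by
  induction j with
  | zero => simp [zeroOrbit, orbitQuotTwo]
  | succ j ih =>
    rw [show 2 * (j + 1) = 2 * j + 1 + 1 by ring, zeroOrbit_succ, zeroOrbit_succ, orbitQuotTwo]
    have h2 : zeroOrbit c 2 = c ^ 2 + c := by simp [zeroOrbit]
    linear_combination (zeroOrbit c (2 * j) + zeroOrbit c 2 * orbitQuotTwo c j) *
      (zeroOrbit c (2 * j) ^ 2 + 2 * c) * ih - h2

theorem zeroOrbit_add_succ (c : R) (l k : ℕ) : zeroOrbit c (l + (k + 1)) + zeroOrbit c l =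
    (zeroOrbit c (l + 1) + zeroOrbit c l) * sumQuotOne c l (k + 1) := by
  induction k with
  | zero => simp [sumQuotOne]
  | succ k ih =>
    rw [sumQuotOne, mul_add, ← mul_assoc, ← ih, ← add_assoc l, zeroOrbit_succ, zeroOrbit_succ]
    ring

theorem zeroOrbit_add_two_mul_succ (c : R) (l j : ℕ) :
    zeroOrbit c (l + 2 * (j + 1)) + zeroOrbit c l =
      (zeroOrbit c (l + 2) + zeroOrbit c l) * sumQuotTwo c l (j + 1) := by
  induction j with
  | zero => simp [sumQuotTwo]
  | succ j ih =>
    rw [sumQuotTwo, show l + 2 * (j + 1 + 1) = l + 2 * (j + 1) + 1 + 1 by ring]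
    have h1 := zeroOrbit_succ c (l + 2 * (j + 1) + 1)
    have h2 := zeroOrbit_succ c (l + 2 * (j + 1))
    have h3 : zeroOrbit c (l + 2) = zeroOrbit c (l + 1) ^ 2 + c := rfl
    have h4 := zeroOrbit_succ c l
    linear_combination h1 - h3 + (zeroOrbit c (l + 2 * (j + 1)) - zeroOrbit c l) *
      (zeroOrbit c (l + 2 * (j + 1) + 1) + zeroOrbit c (l + 1)) * ih +
      (zeroOrbit c (l + 2 * (j + 1) + 1) + zeroOrbit c (l + 1)) * (h2 - h4)

section Map

variable {S : Type*} [CommRing S] (φ : R →+* S) (c : R)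

theorem map_zeroOrbit (i : ℕ) : φ (zeroOrbit c i) = zeroOrbit (φ c) i := by
  induction i with
  | zero => simp [zeroOrbit]
  | succ i ih => simp [zeroOrbit, ih]

theorem map_orbitQuotOne (i : ℕ) : φ (orbitQuotOne c i) = orbitQuotOne (φ c) i := by
  induction i with
  | zero => simp [orbitQuotOne]
  | succ i ih => simp [orbitQuotOne, ih]

theorem map_orbitQuotTwo (i : ℕ) : φ (orbitQuotTwo c i) = orbitQuotTwo (φ c) i := by
  induction i with
  | zero => simp [orbitQuotTwo]
  | succ i ih => simp [orbitQuotTwo, ih, map_zeroOrbit, map_ofNat φ 2]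

theorem map_sumQuotOne (l i : ℕ) : φ (sumQuotOne c l i) = sumQuotOne (φ c) l i := by
  induction i with
  | zero => simp [sumQuotOne]
  | succ i ih => simp [sumQuotOne, ih, map_zeroOrbit]

theorem map_sumQuotTwo (l i : ℕ) : φ (sumQuotTwo c l i) = sumQuotTwo (φ c) l i := by
  induction i with
  | zero => simp [sumQuotTwo]
  | succ i ih => simp [sumQuotTwo, ih, map_zeroOrbit]

end Map

theorem zeroOrbit_add_of_eq {c : R} {p l : ℕ} (h : zeroOrbit c (l + p) = zeroOrbit c l) {i : ℕ}
    (hi : l ≤ i) : zeroOrbit c (i + p) = zeroOrbit c i := by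
  induction i, hi using Nat.le_induction with
  | base => exact h
  | succ i hi ih => rw [add_right_comm, zeroOrbit_succ, ih, zeroOrbit_succ]

theorem zeroOrbit_add_mul_of_eq {c : R} {p l : ℕ} (h : zeroOrbit c (l + p) = zeroOrbit c l) {i : ℕ}
    (hi : l ≤ i) (r : ℕ) : zeroOrbit c (i + p * r) = zeroOrbit c i := by
  induction r with
  | zero => simp
  | succ r ih => rw [mul_add, mul_one, ← add_assoc, zeroOrbit_add_of_eq h (by omega), ih]

theorem zeroOrbit_mul_add {c : R} {k : ℕ} (h : zeroOrbit c k = 0) (M j : ℕ) :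
    zeroOrbit c (j + k * M) = zeroOrbit c j :=
  zeroOrbit_add_mul_of_eq (l := 0) (by simpa [zeroOrbit] using h) (Nat.zero_le j) M

theorem isUnit_of_mk_one_eq_zero {x : R}
    (h : (1 : R ⧸ Ideal.span {x}) = 0) : IsUnit x := by
  rw [← map_one (Ideal.Quotient.mk _), Ideal.Quotient.eq_zero_iff_mem,
    Ideal.mem_span_singleton] at h
  exact isUnit_of_dvd_one h

theorem mk_self_eq_zero (x : R) : Ideal.Quotient.mk (Ideal.span {x}) x = 0 :=
  Ideal.Quotient.eq_zero_iff_mem.2 (Ideal.mem_span_singleton_self x)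

/-- If the cofactor vanishes, the orbit of `0` has period `k`; beyond the preperiod it also has
period `p`. Since `p ∣ k - 1`, this forces `c = a_1 = a_0 = 0`, and then the cofactor equals `1`. -/
theorem one_eq_zero_of_orbitQuotOne {c : R} {p l k : ℕ}
    (h : zeroOrbit c (l + p) = zeroOrbit c l) (hk : k ≠ 0) (hpk : p ∣ k - 1)
    (h0 : orbitQuotOne c k = 0) : (1 : R) = 0 := by
  have hk0 : zeroOrbit c k = 0 := by rw [zeroOrbit_eq_mul, h0, mul_zero]
  obtain ⟨r, hr⟩ := hpk
  -- The index `1 + k l` is past the preperiod and congruent to `1` modulo `k`; adding `k - 1` gives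
  -- `k (l + 1)`.
  have hl : l ≤ 1 + k * l := by nlinarith [Nat.one_le_iff_ne_zero.2 hk]
  have h1 := zeroOrbit_add_mul_of_eq h hl r
  rw [← hr, show 1 + k * l + (k - 1) = 0 + k * (l + 1) by
    rw [mul_add]; omega, zeroOrbit_mul_add hk0, zeroOrbit_mul_add hk0] at h1
  have hc : c = 0 := by simpa [zeroOrbit] using h1.symm
  obtain ⟨k, rfl⟩ := Nat.exists_eq_succ_of_ne_zero hk
  simpa [orbitQuotOne, hc] using h0

/-- Apply the preceding lemma in the quotient by the ideal that the cofactor generates: that ring is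
zero. -/
theorem isUnit_orbitQuotOne {c : R} {p l k : ℕ} (h : zeroOrbit c (l + p) = zeroOrbit c l)
    (hk : k ≠ 0) (hpk : p ∣ k - 1) : IsUnit (orbitQuotOne c k) := by
  refine isUnit_of_mk_one_eq_zero (one_eq_zero_of_orbitQuotOne
    (c := Ideal.Quotient.mk _ c) (l := l) (p := p) (k := k) ?_ hk hpk ?_)
  · rw [← map_zeroOrbit, ← map_zeroOrbit, h]
  · rw [← map_orbitQuotOne, mk_self_eq_zero]

theorem one_eq_zero_of_orbitQuotTwo {c : R} {l j : ℕ} (h : zeroOrbit c (l + 2) = zeroOrbit c l)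
    (hj : j ≠ 0) (h0 : orbitQuotTwo c j = 0) : (1 : R) = 0 := by
  have hk0 : zeroOrbit c (2 * j) = 0 := by rw [zeroOrbit_two_mul, h0, mul_zero]
  have hl : l ≤ 0 + 2 * j * l := by nlinarith [Nat.one_le_iff_ne_zero.2 hj]
  have h1 := zeroOrbit_add_of_eq h hl
  rw [add_right_comm, zeroOrbit_mul_add hk0, zeroOrbit_mul_add hk0, zero_add] at h1
  replace h1 : zeroOrbit c 2 = 0 := h1
  obtain ⟨j, rfl⟩ := Nat.exists_eq_succ_of_ne_zero hj
  rw [orbitQuotTwo, h1] at h0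
  simpa using h0

theorem isUnit_orbitQuotTwo {c : R} {l j : ℕ} (h : zeroOrbit c (l + 2) = zeroOrbit c l)
    (hj : j ≠ 0) : IsUnit (orbitQuotTwo c j) := by
  refine isUnit_of_mk_one_eq_zero (one_eq_zero_of_orbitQuotTwo
    (c := Ideal.Quotient.mk _ c) (l := l) (j := j) ?_ hj ?_)
  · rw [← map_zeroOrbit, ← map_zeroOrbit, h]
  · rw [← map_orbitQuotTwo, mk_self_eq_zero]

/-- From index `l + 1` on the orbit is constant, so every difference `a_{l+k} - a_l` with `k ≥ 1`
equals the multiplier `2 a_{l+1}`. -/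
theorem sumQuotOne_eq_geom {c : R} {l : ℕ} (h : zeroOrbit c (l + 1) + zeroOrbit c l = 0) (k : ℕ) :
    sumQuotOne c l k = ∑ i ∈ Finset.range k, (2 * zeroOrbit c (l + 1)) ^ i := by
  have hp : zeroOrbit c (l + 1 + 1) = zeroOrbit c (l + 1) := by
    rw [zeroOrbit_succ, zeroOrbit_succ c l]
    have := zeroOrbit_succ c l
    linear_combination (zeroOrbit c (l + 1) - zeroOrbit c l) * h -
      (zeroOrbit c (l + 1) + zeroOrbit c l ^ 2 + c) * this
  induction k with
  | zero => simp [sumQuotOne]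
  | succ k ih =>
    rw [sumQuotOne, ih, Finset.sum_range_succ', pow_zero, add_comm]
    congr 1
    simp only [pow_succ, ← Finset.sum_mul]
    rcases Nat.eq_zero_or_pos k with rfl | hk
    · simp
    · have h1 := zeroOrbit_add_mul_of_eq hp le_rfl (k - 1)
      rw [show l + 1 + 1 * (k - 1) = l + k by omega] at h1
      rw [h1]
      congr 1
      linear_combination -h

section PeriodTwo

variable {c : R} {l : ℕ} (h : 1 + zeroOrbit c (l + 1) - zeroOrbit c l = 0)
include h

theorem zeroOrbit_add_two_of_sumQuot : zeroOrbit c (l + 2) = - zeroOrbit c l := by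
  have h1 := zeroOrbit_succ c (l + 1)
  have h2 := zeroOrbit_succ c l
  have h3 : l + 1 + 1 = l + 2 := rfl
  rw [h3] at h1
  linear_combination h1 + (zeroOrbit c (l + 1) + zeroOrbit c l) * h - h2

theorem zeroOrbit_add_three_of_sumQuot : zeroOrbit c (l + 1 + 2) = zeroOrbit c (l + 1) := by
  rw [show l + 1 + 2 = l + 2 + 1 by ring, zeroOrbit_succ, zeroOrbit_add_two_of_sumQuot h,
    zeroOrbit_succ c l, neg_sq]

/-- The cofactor at each positive even index is `1 + a_{l+1} - a_l = 0`, which resets the recursion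
to `1`. -/
theorem sumQuotOne_odd (j : ℕ) : sumQuotOne c l (2 * j + 1) = 1 := by
  induction j with
  | zero => simp [sumQuotOne]
  | succ j ih =>
    rw [show 2 * (j + 1) + 1 = 2 * j + 1 + 1 + 1 by ring, sumQuotOne, sumQuotOne, ih]
    have h1 := zeroOrbit_add_mul_of_eq (zeroOrbit_add_three_of_sumQuot h) le_rfl j
    rw [show l + (2 * j + 1) = l + 1 + 2 * j by ring, h1]
    linear_combination (zeroOrbit c (l + (2 * j + 1 + 1)) - zeroOrbit c l) * h

/-- Here `a_{l+2j} = -a_l` for `j ≥ 1`, so the ratio is `-4 a_l a_{l+1}`, and `-a_l a_{l+1} = c +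
1`. -/
theorem sumQuotTwo_eq_geom (j : ℕ) :
    sumQuotTwo c l j = ∑ i ∈ Finset.range j, (4 * (c + 1)) ^ i := by
  induction j with
  | zero => simp [sumQuotTwo]
  | succ j ih =>
    rw [sumQuotTwo, ih, Finset.sum_range_succ', pow_zero, add_comm]
    congr 1
    simp only [pow_succ, ← Finset.sum_mul]
    rcases Nat.eq_zero_or_pos j with rfl | hj
    · simp
    · have h1 := zeroOrbit_add_mul_of_eq (zeroOrbit_add_three_of_sumQuot h) le_rfl j
      have h2 := zeroOrbit_add_mul_of_eq (zeroOrbit_add_three_of_sumQuot h)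
        (i := l + 2) (by omega) (j - 1)
      rw [show l + 2 + 2 * (j - 1) = l + 2 * j by omega, zeroOrbit_add_two_of_sumQuot h] at h2
      rw [show l + 2 * j + 1 = l + 1 + 2 * j by ring, h1, h2]
      congr 1
      have h3 := zeroOrbit_succ c l
      linear_combination 4 * h3 - 4 * (1 + zeroOrbit c l) * h

end PeriodTwo

end Orbit

/-! ### Monicity of the critical orbit polynomials -/

theorem critOrbit_eq_map (i : ℕ) :
    critOrbit i = (zeroOrbit (X : ℤ[X]) i).map (algebraMap ℤ ℚ) := by
  induction i with
  | zero => simp [critOrbit, zeroOrbit]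
  | succ i ih => simp [critOrbit, zeroOrbit, ih]

theorem monic_zeroOrbit_X (i : ℕ) :
    (zeroOrbit (X : ℤ[X]) (i + 1)).Monic ∧ (zeroOrbit (X : ℤ[X]) (i + 1)).natDegree = 2 ^ i := by
  induction i with
  | zero => simp [zeroOrbit, monic_X]
  | succ i ih =>
    have h1 := ih.1.pow 2
    have h2 : (zeroOrbit (X : ℤ[X]) (i + 1) ^ 2).natDegree = 2 ^ (i + 1) := by
      rw [ih.1.natDegree_pow, ih.2, pow_succ, mul_comm]
    have h3 : (X : ℤ[X]).degree < (zeroOrbit (X : ℤ[X]) (i + 1) ^ 2).degree := by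
      rw [degree_eq_natDegree h1.ne_zero, h2, degree_X]
      exact_mod_cast Nat.one_lt_two_pow (Nat.succ_ne_zero i)
    rw [zeroOrbit_succ]
    exact ⟨h1.add_of_left h3, by rw [natDegree_add_eq_left_of_degree_lt h3, h2]⟩

theorem monic_zeroOrbit_add {l k : ℕ} (hk : k ≠ 0) :
    (zeroOrbit (X : ℤ[X]) (l + k) + zeroOrbit X l).Monic := by
  obtain ⟨k, rfl⟩ := Nat.exists_eq_succ_of_ne_zero hk
  rw [Nat.succ_eq_add_one, ← add_assoc]
  have h1 := monic_zeroOrbit_X (l + k)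
  refine h1.1.add_of_left ?_
  rcases l with _ | l
  · rw [zeroOrbit, degree_zero]
    exact bot_lt_iff_ne_bot.2 (degree_eq_bot.not.2 h1.1.ne_zero)
  · have h2 := monic_zeroOrbit_X l
    rw [degree_eq_natDegree h1.1.ne_zero, degree_eq_natDegree h2.1.ne_zero, h1.2, h2.2]
    exact_mod_cast Nat.pow_lt_pow_right (by norm_num) (by omega)

theorem isMonicIntRatio_misiurewiczRatFunc (l n : ℕ) :
    IsMonicIntRatio (misiurewiczRatFunc (l + 1) n) := by
  unfold misiurewiczRatFunc
  refine .mul (.prod fun k hk => .zpow ?_ _) ?_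
  · have hk0 : k ≠ 0 := (Nat.pos_of_mem_divisors hk).ne'
    rw [critOrbit_eq_map, critOrbit_eq_map, ← Polynomial.map_add,
      show l + 1 + k - 1 = l + k by omega, Nat.add_sub_cancel]
    exact .of_monic (monic_zeroOrbit_add hk0)
  · split_ifs
    · refine .prod fun k hk => .zpow ?_ _
      obtain ⟨j, rfl⟩ := Nat.exists_eq_succ_of_ne_zero (Nat.pos_of_mem_divisors hk).ne'
      rw [critOrbit_eq_map]
      exact .of_monic (monic_zeroOrbit_X j).1
    · exact .one

theorem aeval_critOrbit (c : ℂ) (i : ℕ) : aeval c (critOrbit i) = zeroOrbit c i := by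
  rw [critOrbit_eq_map, aeval_map_algebraMap]
  simpa using map_zeroOrbit (aeval c : ℤ[X] →ₐ[ℤ] ℂ).toRingHom X i

/-! ### Möbius products and cyclotomic values -/

section MoebiusProd

open ArithmeticFunction

variable {F : Type*} [CommGroupWithZero F]

/-- Möbius inversion for the function that is `b` at `1` and `1` elsewhere. -/
theorem prod_const_zpow_moebius {n : ℕ} (hn : 2 ≤ n) {b : F} (hb : b ≠ 0) :
    ∏ k ∈ n.divisors, b ^ moebius (n / k) = 1 := by
  have h := (prod_eq_iff_prod_pow_moebius_eq_of_nonzero (R := F)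
    (f := fun n => if n = 1 then b else 1) (g := fun _ => b)
    (fun n _ => by split_ifs <;> simp [hb]) fun _ _ => hb).1 (fun n hn => by
      rw [Finset.prod_ite_eq' _ _ fun _ => b, if_pos (Nat.one_mem_divisors.2 hn.ne')]) n (by omega)
  rw [Nat.prod_divisorsAntidiagonal' fun i _ => b ^ moebius i, if_neg (by omega)] at h
  exact h

theorem prod_ite_dvd_zpow_moebius {n g : ℕ} (hg : g ∣ n) (hn : n ≠ 0) (f : ℕ → F) :
    ∏ k ∈ n.divisors, (if g ∣ k then f (k / g) else 1) ^ moebius (n / k) =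
      ∏ j ∈ (n / g).divisors, f j ^ moebius (n / g / j) := by
  obtain ⟨N, rfl⟩ := hg
  have hg0 : 0 < g := Nat.pos_of_ne_zero (left_ne_zero_of_mul hn)
  have hN : N ≠ 0 := right_ne_zero_of_mul hn
  rw [Nat.mul_div_cancel_left _ hg0]
  have h1 : N.divisors.map ⟨fun j => g * j, fun _ _ h => Nat.eq_of_mul_eq_mul_left hg0 h⟩ ⊆
      (g * N).divisors := fun k hk => by
    obtain ⟨j, hj, rfl⟩ := Finset.mem_map.1 hk
    exact Nat.mem_divisors.2 ⟨mul_dvd_mul_left g (Nat.dvd_of_mem_divisors hj), hn⟩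
  rw [← Finset.prod_subset h1, Finset.prod_map]
  · refine Finset.prod_congr rfl fun j _ => ?_
    change (if g ∣ g * j then f (g * j / g) else 1) ^ moebius (g * N / (g * j)) = _
    rw [if_pos (dvd_mul_right g j), Nat.mul_div_cancel_left _ hg0, Nat.mul_div_mul_left _ _ hg0]
  · intro k hk hk'
    rw [if_neg, one_zpow]
    rintro ⟨j, rfl⟩
    exact hk' (Finset.mem_map.2 ⟨j, Nat.mem_divisors.2
      ⟨Nat.dvd_of_mul_dvd_mul_left hg0 (Nat.dvd_of_mem_divisors hk), hN⟩, rfl⟩)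

theorem prod_ite_const_zpow_moebius {n g : ℕ} (hg : g ∣ n) (hn : 2 ≤ n / g) {b b' : F}
    (hb : b ≠ 0) (hb' : b' ≠ 0) :
    ∏ k ∈ n.divisors, (if g ∣ k then b else b') ^ moebius (n / k) = 1 := by
  have hn' : 2 ≤ n := hn.trans (Nat.div_le_self n g)
  have h1 : ∀ k, (if g ∣ k then b else b') = b' * (if g ∣ k then b / b' else 1) := fun k => by
    split_ifs
    · rw [mul_div_cancel₀ _ hb']
    · rw [mul_one]
  simp_rw [h1, mul_zpow, Finset.prod_mul_distrib]
  rw [prod_const_zpow_moebius hn' hb',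
    prod_ite_dvd_zpow_moebius hg (by omega) (fun _ => b / b'),
    prod_const_zpow_moebius hn (div_ne_zero hb hb'), mul_one]

/-- Geometric sums replace `x ^ j - 1`, which amounts to replacing `Φ_1` by `1`; the formula then
also makes sense at `x = 1`. -/
theorem eval_cyclotomic_eq_prod {K : Type*} [Field K] {x : K}
    (hx : ∀ j, 0 < j → ∑ i ∈ Finset.range j, x ^ i ≠ 0) {n : ℕ} (hn : 2 ≤ n) :
    eval x (cyclotomic n K) =
      ∏ j ∈ n.divisors, (∑ i ∈ Finset.range j, x ^ i) ^ moebius (n / j) := by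
  have hprod : ∀ n > 0, ∏ i ∈ n.divisors, (if i = 1 then 1 else eval x (cyclotomic i K)) =
      ∑ i ∈ Finset.range n, x ^ i := fun n hn => by
    have h1 := congrArg (eval x) (prod_cyclotomic_eq_geom_sum hn K)
    rw [eval_prod, eval_geom_sum] at h1
    rw [← h1, ← Finset.mul_prod_erase _ _ (Nat.one_mem_divisors.2 hn.ne'), if_pos rfl, one_mul]
    exact Finset.prod_congr rfl fun i hi => if_neg (Finset.ne_of_mem_erase hi)
  have h := (prod_eq_iff_prod_pow_moebius_eq_of_nonzero (R := K)
    (f := fun n => if n = 1 then 1 else eval x (cyclotomic n K))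
    (g := fun n => ∑ i ∈ Finset.range n, x ^ i)
    (fun n hn => by
      have h2 := hx n hn
      rw [← hprod n hn] at h2
      exact Finset.prod_ne_zero_iff.1 h2 n (Nat.mem_divisors_self n hn.ne')) hx).1 hprod n (by omega)
  rw [Nat.prod_divisorsAntidiagonal' fun i j => (∑ i ∈ Finset.range j, x ^ i) ^ moebius i,
    if_neg (by omega)] at h
  exact h.symm

end MoebiusProd

/-- If the value of `G_{l+1,n}` at `c` is a unit, and the factors of `G_{l+1,n}` can be written,
up to factors that cancel in the Möbius product, such that their values at `c` are geometric sums
in `x` or units, then `Φ_{n/g}(x)` is a unit. -/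
theorem isAlgUnit_cyclotomic_of_misiurewicz {l n g : ℕ} (hg : g ∣ n) (hn : 2 ≤ n / g)
    {c x : ℂ} (hc : IsIntegral ℤ c) (hx : IsIntegral ℤ x)
    (hx1 : ∀ j, 0 < j → ∑ i ∈ Finset.range j, x ^ i ≠ 0)
    {b b' d d' : ℤ[X]} (hb : b ≠ 0) (hb' : b' ≠ 0) (hd : d ≠ 0) (hd' : d' ≠ 0) {E e : ℕ → ℤ[X]}
    (hF : ∀ k, k ≠ 0 →
      zeroOrbit (X : ℤ[X]) (l + k) + zeroOrbit X l = (if g ∣ k then b else b') * E k)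
    (ha : ∀ k, k ≠ 0 → zeroOrbit (X : ℤ[X]) k = (if g ∣ k then d else d') * e k)
    (hE : ∀ k, k ≠ 0 →
      aeval c (E k) = if g ∣ k then ∑ i ∈ Finset.range (k / g), x ^ i else 1)
    (he : ∀ k, k ≠ 0 → IsAlgUnit (aeval c (e k)))
    (hG : IsAlgUnit (aeval c (misiurewicz (l + 1) n))) :
    IsAlgUnit (eval x (cyclotomic (n / g) ℂ)) := by
  have hn0 : n ≠ 0 := by rintro rfl; simp at hn
  have hg0 : 0 < g := Nat.pos_of_ne_zero (by rintro rfl; simp at hn)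
  set ι : ℤ[X] → RatFunc ℚ := fun p => algebraMap ℚ[X] (RatFunc ℚ) (p.map (algebraMap ℤ ℚ))
    with hι
  have hι0 : ∀ {p : ℤ[X]}, p ≠ 0 → ι p ≠ 0 := fun {p} hp => by
    refine (map_ne_zero_iff _ (RatFunc.algebraMap_injective ℚ)).2 ?_
    exact (Polynomial.map_ne_zero_iff (RingHom.injective_int (algebraMap ℤ ℚ))).2 hp
  have hιmul : ∀ p q : ℤ[X], ι (p * q) = ι p * ι q := fun p q => by
    simp only [hι, Polynomial.map_mul, map_mul]
  have hιite : ∀ (P : Prop) [Decidable P] (p q : ℤ[X]),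
      ι (if P then p else q) = if P then ι p else ι q := fun P _ p q => apply_ite ι P p q
  have hval : ∀ p : ℤ[X], HasValueAt c (ι p) (aeval c p) := fun p => by
    have := HasValueAt.of_poly (c := c) (p.map (algebraMap ℤ ℚ))
    rwa [aeval_map_algebraMap] at this
  have hk0 : ∀ {k}, k ∈ n.divisors → k ≠ 0 := fun hk => (Nat.pos_of_mem_divisors hk).ne'
  -- the first factor
  have h1 : HasValueAt c (∏ k ∈ n.divisors,
      algebraMap ℚ[X] (RatFunc ℚ) (critOrbit (l + 1 + k - 1) + critOrbit (l + 1 - 1)) ^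
        (ArithmeticFunction.moebius (n / k))) (eval x (cyclotomic (n / g) ℂ)) := by
    have e1 : ∀ k ∈ n.divisors,
        algebraMap ℚ[X] (RatFunc ℚ) (critOrbit (l + 1 + k - 1) + critOrbit (l + 1 - 1)) ^
          (ArithmeticFunction.moebius (n / k)) =
        (if g ∣ k then ι b else ι b') ^ (ArithmeticFunction.moebius (n / k)) *
          ι (E k) ^ (ArithmeticFunction.moebius (n / k)) := fun k hk => by
      rw [critOrbit_eq_map, critOrbit_eq_map, ← Polynomial.map_add,
        show l + 1 + k - 1 = l + k by omega, Nat.add_sub_cancel, hF k (hk0 hk), ← mul_zpow,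
        ← hιite, ← hιmul]
    rw [Finset.prod_congr rfl e1, Finset.prod_mul_distrib,
      prod_ite_const_zpow_moebius hg hn (hι0 hb) (hι0 hb'), one_mul,
      eval_cyclotomic_eq_prod hx1 hn,
      ← prod_ite_dvd_zpow_moebius hg hn0 fun j => ∑ i ∈ Finset.range j, x ^ i]
    refine .prod fun k hk => ?_
    rw [← hE k (hk0 hk)]
    refine (hval (E k)).zpow ?_ _
    rw [hE k (hk0 hk)]
    split_ifs with hgk
    · exact hx1 _ (Nat.div_pos (Nat.le_of_dvd (Nat.pos_of_ne_zero (hk0 hk)) hgk) hg0)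
    · exact one_ne_zero
  -- the second factor
  obtain ⟨w, hw, h2⟩ : ∃ w, IsAlgUnit w ∧ HasValueAt c (if n ∣ l + 1 - 1 then
      ∏ k ∈ n.divisors,
        algebraMap ℚ[X] (RatFunc ℚ) (critOrbit k) ^ (-ArithmeticFunction.moebius (n / k))
      else 1) w := by
    split_ifs
    · refine ⟨∏ k ∈ n.divisors, aeval c (e k) ^ (-ArithmeticFunction.moebius (n / k)),
        .prod fun k hk => (he k (hk0 hk)).zpow _, ?_⟩
      have e1 : ∀ k ∈ n.divisors,
          algebraMap ℚ[X] (RatFunc ℚ) (critOrbit k) ^ (-ArithmeticFunction.moebius (n / k)) =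
          ((if g ∣ k then ι d else ι d') ^ (ArithmeticFunction.moebius (n / k)))⁻¹ *
            ι (e k) ^ (-ArithmeticFunction.moebius (n / k)) := fun k hk => by
        rw [critOrbit_eq_map, ha k (hk0 hk), ← zpow_neg, ← mul_zpow, ← hιite, ← hιmul]
      rw [Finset.prod_congr rfl e1, Finset.prod_mul_distrib, Finset.prod_inv_distrib,
        prod_ite_const_zpow_moebius hg hn (hι0 hd) (hι0 hd'), inv_one, one_mul]
      exact .prod fun k hk => (hval (e k)).zpow (he k (hk0 hk)).1 _
    · exact ⟨1, .one, .one⟩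
  have h3 := (h1.mul h2).aeval_num
  -- Only the integrality of the value of the reduced denominator `D` at `c` is needed.
  obtain ⟨D, -, hD⟩ := (isMonicIntRatio_misiurewiczRatFunc l n).exists_denom
  have hnum : aeval c (misiurewicz (l + 1) n) =
      eval x (cyclotomic (n / g) ℂ) * (w * aeval c D) := by
    rw [← mul_assoc, ← aeval_map_algebraMap ℚ c D, hD]
    exact h3
  rw [hnum] at hG
  refine .of_mul ?_ (hw.2.1.mul (isIntegral_aeval_int hc D)) hG
  rw [← map_cyclotomic_int, ← algebraMap_int_eq, eval_map_algebraMap]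
  exact isIntegral_aeval_int hx _

/-! ### Values of Misiurewicz polynomials at preperiodic parameters -/

section IntEval

variable (c : ℂ)

theorem aeval_zeroOrbit (i : ℕ) : aeval c (zeroOrbit (X : ℤ[X]) i) = zeroOrbit c i := by
  simpa using map_zeroOrbit (aeval c : ℤ[X] →ₐ[ℤ] ℂ).toRingHom X i

theorem aeval_orbitQuotOne (i : ℕ) : aeval c (orbitQuotOne (X : ℤ[X]) i) = orbitQuotOne c i := by
  simpa using map_orbitQuotOne (aeval c : ℤ[X] →ₐ[ℤ] ℂ).toRingHom X i

theorem aeval_orbitQuotTwo (i : ℕ) : aeval c (orbitQuotTwo (X : ℤ[X]) i) = orbitQuotTwo c i := by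
  simpa using map_orbitQuotTwo (aeval c : ℤ[X] →ₐ[ℤ] ℂ).toRingHom X i

theorem aeval_sumQuotOne (l i : ℕ) :
    aeval c (sumQuotOne (X : ℤ[X]) l i) = sumQuotOne c l i := by
  simpa using map_sumQuotOne (aeval c : ℤ[X] →ₐ[ℤ] ℂ).toRingHom X l i

theorem aeval_sumQuotTwo (l i : ℕ) :
    aeval c (sumQuotTwo (X : ℤ[X]) l i) = sumQuotTwo c l i := by
  simpa using map_sumQuotTwo (aeval c : ℤ[X] →ₐ[ℤ] ℂ).toRingHom X l i

end IntEval

section AlgUnit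

variable {c : ℂ} (hc : IsIntegral ℤ c)
include hc

theorem isAlgUnit_orbitQuotOne {p l k : ℕ} (h : zeroOrbit c (l + p) = zeroOrbit c l)
    (hk : k ≠ 0) (hpk : p ∣ k - 1) : IsAlgUnit (orbitQuotOne c k) := by
  let φ := algebraMap (integralClosure ℤ ℂ) ℂ
  have hφ : c = φ ⟨c, hc⟩ := rfl
  rw [hφ, ← map_zeroOrbit, ← map_zeroOrbit] at h
  rw [hφ, ← map_orbitQuotOne]
  exact .of_isUnit (isUnit_orbitQuotOne (Subtype.ext h) hk hpk)

theorem isAlgUnit_orbitQuotTwo {l j : ℕ} (h : zeroOrbit c (l + 2) = zeroOrbit c l)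
    (hj : j ≠ 0) : IsAlgUnit (orbitQuotTwo c j) := by
  let φ := algebraMap (integralClosure ℤ ℂ) ℂ
  have hφ : c = φ ⟨c, hc⟩ := rfl
  rw [hφ, ← map_zeroOrbit, ← map_zeroOrbit] at h
  rw [hφ, ← map_orbitQuotTwo]
  exact .of_isUnit (isUnit_orbitQuotTwo (Subtype.ext h) hj)

theorem isIntegral_zeroOrbit (i : ℕ) : IsIntegral ℤ (zeroOrbit c i) := by
  rw [← aeval_zeroOrbit]
  exact isIntegral_aeval_int hc _

end AlgUnit

/-- The sum is `1` plus twice an algebraic integer; if it vanished, `1/2` would be integral. -/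
theorem geom_sum_two_mul_ne_zero {y : ℂ} (hy : IsIntegral ℤ y) {j : ℕ} (hj : 0 < j) :
    ∑ i ∈ Finset.range j, (2 * y) ^ i ≠ 0 := by
  obtain ⟨j, rfl⟩ := Nat.exists_eq_succ_of_ne_zero hj.ne'
  intro h
  simp only [Nat.succ_eq_add_one, Finset.sum_range_succ', pow_zero, pow_succ,
    ← Finset.sum_mul] at h
  have h2 : IsIntegral ℤ (2 : ℂ) := by
    simpa using isIntegral_algebraMap (R := ℤ) (A := ℂ) (x := 2)
  have h1 : IsIntegral ℤ (((1 : ℤ) : ℂ) / (2 : ℤ)) := by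
    have : (((1 : ℤ) : ℂ) / (2 : ℤ)) = -((∑ i ∈ Finset.range j, (2 * y) ^ i) * y) := by
      push_cast
      linear_combination h / 2
    rw [this]
    exact ((IsIntegral.sum _ fun i _ => (h2.mul hy).pow i).mul hy).neg
  exact absurd (isIntegral_intCast_div_imp (by norm_num) h1) (by norm_num)

/-- At a parameter where `0` eventually lands on a fixed point of multiplier `x`, the value of the
Misiurewicz polynomial for period `n` is associated to `Φ_n(x)`. -/
theorem isAlgUnit_cyclotomic_fixed {l n : ℕ} (hn : 2 ≤ n) {c : ℂ} (hc : IsIntegral ℤ c)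
    (h : zeroOrbit c (l + 1) + zeroOrbit c l = 0)
    (hG : IsAlgUnit (aeval c (misiurewicz (l + 1) n))) :
    IsAlgUnit (eval (2 * zeroOrbit c (l + 1)) (cyclotomic n ℂ)) := by
  have h2 : IsIntegral ℤ (2 : ℂ) := by
    simpa using isIntegral_algebraMap (R := ℤ) (A := ℂ) (x := 2)
  have hp : zeroOrbit c (l + 1 + 1) = zeroOrbit c (l + 1) := by
    have h1 := zeroOrbit_succ c (l + 1)
    have h3 := zeroOrbit_succ c l
    linear_combination h1 - h3 + (zeroOrbit c (l + 1) - zeroOrbit c l) * h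
  have hF0 : zeroOrbit (X : ℤ[X]) (l + 1) + zeroOrbit X l ≠ 0 :=
    (monic_zeroOrbit_add one_ne_zero).ne_zero
  have key := isAlgUnit_cyclotomic_of_misiurewicz (l := l) (n := n) (g := 1) (one_dvd n)
    (by simpa using hn) hc (h2.mul (isIntegral_zeroOrbit hc (l + 1)))
    (fun j hj => geom_sum_two_mul_ne_zero (isIntegral_zeroOrbit hc (l + 1)) hj)
    hF0 hF0 X_ne_zero X_ne_zero (E := sumQuotOne X l) (e := orbitQuotOne X)
    (fun k hk => ?_) (fun k _ => ?_) (fun k _ => ?_) (fun k hk => ?_) hG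
  · simpa using key
  · obtain ⟨k, rfl⟩ := Nat.exists_eq_succ_of_ne_zero hk
    rw [ite_self]
    exact zeroOrbit_add_succ _ _ _
  · rw [ite_self]
    exact zeroOrbit_eq_mul _ _
  · rw [if_pos (one_dvd k), Nat.div_one, aeval_sumQuotOne]
    exact sumQuotOne_eq_geom h k
  · rw [aeval_orbitQuotOne]
    exact isAlgUnit_orbitQuotOne hc hp hk (one_dvd _)

/-- At a parameter where `0` eventually lands on a `2`-cycle, whose multiplier is then
`4 * (c + 1)`, the value of the Misiurewicz polynomial for period `n` is associated to
`Φ_{n/2}(4 * (c + 1))`. -/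
theorem isAlgUnit_cyclotomic_two_cycle {l n : ℕ} (hn : 2 ≤ n / 2) (h2n : 2 ∣ n) {c : ℂ}
    (hc : IsIntegral ℤ c) (h : 1 + zeroOrbit c (l + 1) - zeroOrbit c l = 0)
    (hG : IsAlgUnit (aeval c (misiurewicz (l + 1) n))) :
    IsAlgUnit (eval (4 * (c + 1)) (cyclotomic (n / 2) ℂ)) := by
  have h2 : IsIntegral ℤ (2 : ℂ) := by
    simpa using isIntegral_algebraMap (R := ℤ) (A := ℂ) (x := 2)
  have hy : IsIntegral ℤ (2 * (c + 1)) := h2.mul (hc.add isIntegral_one)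
  have hxy : 4 * (c + 1) = 2 * (2 * (c + 1)) := by ring
  have hp := zeroOrbit_add_three_of_sumQuot h
  refine isAlgUnit_cyclotomic_of_misiurewicz (l := l) (n := n) (g := 2) h2n
    hn hc (hxy ▸ h2.mul hy) (fun j hj => hxy ▸ geom_sum_two_mul_ne_zero hy hj)
    (b := zeroOrbit X (l + 2) + zeroOrbit X l) (b' := zeroOrbit X (l + 1) + zeroOrbit X l)
    (monic_zeroOrbit_add two_ne_zero).ne_zero (monic_zeroOrbit_add one_ne_zero).ne_zero
    (d := zeroOrbit X 2) (d' := X) (monic_zeroOrbit_X 1).1.ne_zero X_ne_zero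
    (E := fun k => if 2 ∣ k then sumQuotTwo X l (k / 2) else sumQuotOne X l k)
    (e := fun k => if 2 ∣ k then orbitQuotTwo X (k / 2) else orbitQuotOne X k)
    (fun k hk => ?_) (fun k _ => ?_) (fun k _ => ?_) (fun k hk => ?_) hG
  · split_ifs with hk2
    · obtain ⟨j, rfl⟩ := hk2
      obtain ⟨j, rfl⟩ := Nat.exists_eq_succ_of_ne_zero (right_ne_zero_of_mul hk)
      rw [Nat.mul_div_cancel_left _ two_pos]
      exact zeroOrbit_add_two_mul_succ _ _ _
    · obtain ⟨k, rfl⟩ := Nat.exists_eq_succ_of_ne_zero hk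
      exact zeroOrbit_add_succ _ _ _
  · split_ifs with hk2
    · obtain ⟨j, rfl⟩ := hk2
      rw [Nat.mul_div_cancel_left _ two_pos]
      exact zeroOrbit_two_mul _ _
    · exact zeroOrbit_eq_mul _ _
  · split_ifs with hk2
    · rw [aeval_sumQuotTwo, sumQuotTwo_eq_geom h]
    · obtain ⟨j, rfl⟩ := Nat.odd_iff.2 (Nat.two_dvd_ne_zero.1 hk2)
      rw [aeval_sumQuotOne, sumQuotOne_odd h]
  · split_ifs with hk2
    · rw [aeval_orbitQuotTwo]
      exact isAlgUnit_orbitQuotTwo hc hp (by omega)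
    · rw [aeval_orbitQuotOne]
      exact isAlgUnit_orbitQuotOne hc hp hk (by omega)

theorem exists_monic_map_eq_misiurewicz (l n : ℕ) :
    ∃ p : ℤ[X], p.Monic ∧ p.map (algebraMap ℤ ℚ) = misiurewicz (l + 1) n :=
  (isMonicIntRatio_misiurewiczRatFunc l n).exists_num

theorem isAlgUnit_aeval_misiurewicz_of_root {l n g : ℕ} (hirr : Irreducible (misiurewicz (l + 1) n))
    {c₀ : ℂ} (hc₀ : aeval c₀ (misiurewicz (l + 1) n) = 0)
    (h : IsAlgUnit (aeval c₀ (misiurewicz (l + 1) g))) {c : ℂ}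
    (hc : aeval c (misiurewicz (l + 1) g) = 0) :
    IsIntegral ℤ c ∧ IsAlgUnit (aeval c (misiurewicz (l + 1) n)) := by
  obtain ⟨p, hp, hpm⟩ := exists_monic_map_eq_misiurewicz l g
  obtain ⟨q, hq, hqm⟩ := exists_monic_map_eq_misiurewicz l n
  rw [← hqm, aeval_map_algebraMap] at hc₀ ⊢
  rw [← hpm, aeval_map_algebraMap] at h hc
  rw [← hqm] at hirr
  have hci : IsIntegral ℤ c := ⟨p, hp, hc⟩
  exact ⟨hci, isAlgUnit_of_isCoprime (isCoprime_of_isAlgUnit hq hirr hc₀ h) hci hc⟩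

/-- Since `n = 1` divides `l`, the product is divided by `a_1 = c`, hence the condition `c ≠ 0`. -/
theorem aeval_misiurewicz_one_eq_zero {l : ℕ} {c : ℂ} (hc : c ≠ 0)
    (h : zeroOrbit c (l + 1) + zeroOrbit c l = 0) : aeval c (misiurewicz (l + 1) 1) = 0 := by
  have hr : misiurewiczRatFunc (l + 1) 1 =
      algebraMap ℚ[X] (RatFunc ℚ) (critOrbit (l + 1) + critOrbit l) *
        (algebraMap ℚ[X] (RatFunc ℚ) (critOrbit 1))⁻¹ := by
    simp [misiurewiczRatFunc]
  have h1 := (HasValueAt.of_poly (c := c) (critOrbit (l + 1) + critOrbit l)).mul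
    ((HasValueAt.of_poly (c := c) (critOrbit 1)).inv (by simpa [critOrbit] using hc))
  rw [← hr] at h1
  rw [misiurewicz, h1.aeval_num, map_add, aeval_critOrbit, aeval_critOrbit, h]
  ring

/-- For `n = 2` the first Möbius product is `1 + a_{l+1} - a_l`, as `a_{l+2} + a_l` is divisible by
`a_{l+1} + a_l`. The condition on `c` keeps `a_2 = c (c + 1)`, a possible divisor, away from zero.
-/
theorem aeval_misiurewicz_two_eq_zero {l : ℕ} {c : ℂ} (hc : c + 1 ≠ 0)
    (h : 1 + zeroOrbit c (l + 1) - zeroOrbit c l = 0) :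
    aeval c (misiurewicz (l + 1) 2) = 0 := by
  have hc0 : c ≠ 0 := by
    rintro rfl
    simp [zeroOrbit_eq_mul] at h
  have hF : critOrbit (l + 2) + critOrbit l =
      (critOrbit (l + 1) + critOrbit l) * (1 + critOrbit (l + 1) - critOrbit l) := by
    simp only [critOrbit]
    ring
  have hF0 : algebraMap ℚ[X] (RatFunc ℚ) (critOrbit (l + 1) + critOrbit l) ≠ 0 := by
    refine (map_ne_zero_iff _ (RatFunc.algebraMap_injective ℚ)).2 ?_
    rw [critOrbit_eq_map, critOrbit_eq_map, ← Polynomial.map_add]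
    exact ((monic_zeroOrbit_add one_ne_zero).map _).ne_zero
  obtain ⟨s, v, hs, hr⟩ : ∃ s v, HasValueAt c s v ∧ misiurewiczRatFunc (l + 1) 2 =
      algebraMap ℚ[X] (RatFunc ℚ) (1 + critOrbit (l + 1) - critOrbit l) * s := by
    have hμ : ArithmeticFunction.moebius 2 = -1 :=
      ArithmeticFunction.moebius_apply_prime Nat.prime_two
    have e1 : ∏ k ∈ Nat.divisors 2,
        algebraMap ℚ[X] (RatFunc ℚ) (critOrbit (l + 1 + k - 1) + critOrbit (l + 1 - 1)) ^
          (ArithmeticFunction.moebius (2 / k)) =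
        algebraMap ℚ[X] (RatFunc ℚ) (1 + critOrbit (l + 1) - critOrbit l) := by
      rw [Nat.Prime.divisors Nat.prime_two, Finset.prod_pair (by norm_num), Nat.div_one, hμ,
        Nat.div_self two_pos, ArithmeticFunction.moebius_apply_one, zpow_neg, zpow_one, zpow_one,
        show l + 1 + 2 - 1 = l + 2 by omega, Nat.add_sub_cancel, Nat.add_sub_cancel, hF, map_mul,
        inv_mul_cancel_left₀ hF0]
    rw [misiurewiczRatFunc, e1]
    split_ifs
    · refine ⟨_, _, .prod (g := fun k => aeval c (critOrbit k) ^
        (-ArithmeticFunction.moebius (2 / k))) fun k hk => (HasValueAt.of_poly _).zpow ?_ _, rfl⟩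
      rw [Nat.Prime.divisors Nat.prime_two, Finset.mem_insert, Finset.mem_singleton] at hk
      rcases hk with rfl | rfl
      · simpa [critOrbit] using hc0
      · have : aeval c (critOrbit 2) = c * (c + 1) := by
          simp [critOrbit]; ring
        rw [this]
        exact mul_ne_zero hc0 hc
    · exact ⟨1, 1, .one, rfl⟩
  have h1 := (HasValueAt.of_poly (c := c) (1 + critOrbit (l + 1) - critOrbit l)).mul hs
  rw [← hr] at h1
  rw [misiurewicz, h1.aeval_num, map_sub, map_add, map_one, aeval_critOrbit, aeval_critOrbit, h]
  ring

/-- The substitution `z = b (1 - 2 w)` carries `z ^ 2 + c`, with fixed point `b`, to the logistic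
map of parameter `2 b`; here `w = -logisticOrbit i / 2 ^ 2 ^ i`. -/
theorem zeroOrbit_of_logistic {b c : ℂ} (hc : c = b - b ^ 2) (i : ℕ) :
    2 ^ 2 ^ i * zeroOrbit c i = b * (2 ^ 2 ^ i + 2 * aeval (2 * b) (logisticOrbit i)) := by
  induction i with
  | zero => simp [zeroOrbit, logisticOrbit]
  | succ i ih =>
    rw [zeroOrbit, logisticOrbit, pow_succ 2 i, pow_mul]
    simp only [map_mul, map_add, map_pow, aeval_X, map_ofNat]
    rw [hc] at ih ⊢
    linear_combination (2 ^ 2 ^ i * zeroOrbit (b - b ^ 2) i +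
      b * (2 ^ 2 ^ i + 2 * aeval (2 * b) (logisticOrbit i))) * ih

theorem zeroOrbit_of_shifted (c : ℂ) (i : ℕ) :
    2 ^ 2 ^ i * zeroOrbit c i = aeval (4 * (c + 1)) (shiftedOrbit i) := by
  induction i with
  | zero => simp [zeroOrbit, shiftedOrbit]
  | succ i ih =>
    rw [zeroOrbit, shiftedOrbit]
    simp only [map_mul, map_add, map_sub, map_pow, aeval_X, map_ofNat]
    have h1 : (2 : ℂ) ^ 2 ^ (i + 1) = 2 ^ (2 ^ (i + 1) - 2) * 4 := by
      rw [show (4 : ℂ) = 2 ^ 2 by norm_num, ← pow_add, Nat.sub_add_cancel]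
      rw [pow_succ]
      have := Nat.one_le_two_pow (n := i)
      omega
    have h2 : (2 : ℂ) ^ 2 ^ (i + 1) = (2 ^ 2 ^ i) ^ 2 := by rw [pow_succ 2 i, pow_mul]
    rw [← ih]
    linear_combination zeroOrbit c i ^ 2 * h2 + c * h1

/-! ### The contradiction for fixed points and for 2-cycles -/

section NotUnit

variable {l n : ℕ} (hl : 1 ≤ l) (hn : 2 ≤ n) (hirr : Irreducible (misiurewicz (l + 1) n))
  {c₀ : ℂ} (hc₀ : aeval c₀ (misiurewicz (l + 1) n) = 0)
include hl hn hirr hc₀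

theorem not_isAlgUnit_misiurewicz_one : ¬ IsAlgUnit (aeval c₀ (misiurewicz (l + 1) 1)) := by
  intro hu
  obtain ⟨k, P, hk, hP, hroot⟩ := exists_isTwoAdicShift_logistic hl
  have hζ := Complex.isPrimitiveRoot_exp n (by omega)
  set ζ := Complex.exp (2 * Real.pi * Complex.I / n)
  refine hP.not_isAlgUnit hk (by omega) hζ.pow_eq_one (isAlgUnit_aeval_of_roots hP.monic ?_)
  intro x hx
  -- The root `x = 0` corresponds to `c = 0`, which must be set aside, but `ζ - 0` is a unit anyway.
  rcases eq_or_ne x 0 with rfl | hx0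
  · rw [sub_zero]
    exact .of_root_of_unity (by omega) hζ.pow_eq_one
  have hT : (2 : ℂ) ^ 2 ^ l ≠ 0 := pow_ne_zero _ two_ne_zero
  set b := x / 2 with hb
  set c := b - b ^ 2 with hc
  have hxb : x = 2 * b := by rw [hb]; ring
  have h1 := zeroOrbit_of_logistic hc l
  rw [← hxb, hroot x hx] at h1
  have ha : zeroOrbit c l = -b := by
    apply mul_left_cancel₀ hT
    linear_combination h1
  have ha' : zeroOrbit c (l + 1) = b := by
    rw [zeroOrbit_succ, ha, hc]; ring
  have hsum : zeroOrbit c (l + 1) + zeroOrbit c l = 0 := by rw [ha, ha']; ring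
  have hc0 : c ≠ 0 := by
    intro h0
    rw [zeroOrbit_eq_mul, h0, zero_mul] at ha
    exact hx0 (by linear_combination hxb + 2 * ha)
  obtain ⟨hci, hG⟩ := isAlgUnit_aeval_misiurewicz_of_root hirr hc₀ hu
    (aeval_misiurewicz_one_eq_zero hc0 hsum)
  have h2 := isAlgUnit_cyclotomic_fixed hn hci hsum hG
  rw [ha', ← hxb] at h2
  exact .sub_of_cyclotomic (by omega) hζ ⟨P, hP.monic, hx⟩ h2

theorem not_isAlgUnit_misiurewicz_two (h2n : Even n) :
    ¬ IsAlgUnit (aeval c₀ (misiurewicz (l + 1) 2)) := by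
  intro hu
  -- For `n = 2` the value is zero; otherwise `n / 2 ≥ 2`, as the Möbius cancellation requires.
  rcases hn.eq_or_lt with rfl | hn2
  · exact hu.1 hc₀
  obtain ⟨k, P, hk, hP, hroot⟩ := exists_isTwoAdicShift_shifted hl
  have hn' : 2 ≤ n / 2 := by
    obtain ⟨j, rfl⟩ := h2n
    omega
  have hζ := Complex.isPrimitiveRoot_exp (n / 2) (by omega)
  set ζ := Complex.exp (2 * Real.pi * Complex.I / (n / 2 : ℕ))
  refine hP.not_isAlgUnit hk (by omega) hζ.pow_eq_one (isAlgUnit_aeval_of_roots hP.monic ?_)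
  intro x hx
  -- The root `x = 0` corresponds to `c = -1`, where `a_2` vanishes.
  rcases eq_or_ne x 0 with rfl | hx0
  · rw [sub_zero]
    exact .of_root_of_unity (by omega) hζ.pow_eq_one
  obtain ⟨c, rfl⟩ : ∃ c, x = 4 * (c + 1) := ⟨x / 4 - 1, by ring⟩
  have hT : (2 : ℂ) ^ 2 ^ (l + 1) ≠ 0 := pow_ne_zero _ two_ne_zero
  have hsum : 1 + zeroOrbit c (l + 1) - zeroOrbit c l = 0 := by
    have h1 := hroot _ hx
    rw [← zeroOrbit_of_shifted, ← zeroOrbit_of_shifted] at h1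
    have h2 : (2 : ℂ) ^ 2 ^ (l + 1) = (2 ^ 2 ^ l) ^ 2 := by rw [pow_succ 2 l, pow_mul]
    refine (mul_eq_zero.1 ?_).resolve_left hT
    linear_combination h1 - zeroOrbit c l * h2
  obtain ⟨hci, hG⟩ := isAlgUnit_aeval_misiurewicz_of_root hirr hc₀ hu
    (aeval_misiurewicz_two_eq_zero (right_ne_zero_of_mul hx0) hsum)
  have h2 := isAlgUnit_cyclotomic_two_cycle hn' h2n.two_dvd hci hsum hG
  exact .sub_of_cyclotomic (by omega) hζ ⟨P, hP.monic, hx⟩ h2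

end NotUnit

/-! ### Passage to the ring of integers of `ℚ(c₀)` -/

theorem isAlgUnit_of_isUnit_ringOfIntegers {K : IntermediateField ℚ ℂ}
    {x : NumberField.RingOfIntegers K} (hx : IsUnit x) : IsAlgUnit ((x : K) : ℂ) := by
  have hint : ∀ y : NumberField.RingOfIntegers K, IsIntegral ℤ ((y : K) : ℂ) := fun y =>
    (NumberField.RingOfIntegers.isIntegral_coe y).algebraMap (B := ℂ)
  obtain ⟨y, hy⟩ := hx.exists_right_inv
  have hy' : ((x : K) : ℂ) * ((y : K) : ℂ) = 1 := by
    have := congrArg (fun z : NumberField.RingOfIntegers K => ((z : K) : ℂ)) hy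
    simpa using this
  exact .of_mul (hint x) (hint y) (by rw [hy']; exact .one)

theorem exists_ringOfIntegers_eq_misiurewicz {l n g : ℕ} {c₀ : ℂ}
    (hc₀ : aeval c₀ (misiurewicz (l + 1) n) = 0) :
    ∃ x : NumberField.RingOfIntegers (IntermediateField.adjoin ℚ {c₀}),
      ((x : IntermediateField.adjoin ℚ {c₀}) : ℂ) = aeval c₀ (misiurewicz (l + 1) g) := by
  obtain ⟨p, hp, hpm⟩ := exists_monic_map_eq_misiurewicz l g
  obtain ⟨q, hq, hqm⟩ := exists_monic_map_eq_misiurewicz l n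
  rw [← hqm, aeval_map_algebraMap] at hc₀
  rw [← hpm, aeval_map_algebraMap]
  let K := IntermediateField.adjoin ℚ {c₀}
  let γ : K := IntermediateField.AdjoinSimple.gen ℚ c₀
  have hγ : algebraMap K ℂ γ = c₀ := IntermediateField.AdjoinSimple.algebraMap_gen ℚ c₀
  have hγi : IsIntegral ℤ γ := by
    refine (isIntegral_algebraMap_iff (algebraMap K ℂ).injective).1 ?_
    rw [hγ]
    exact ⟨q, hq, hc₀⟩
  refine ⟨⟨aeval γ p, isIntegral_aeval_int hγi p⟩, ?_⟩
  have h1 := aeval_algebraMap_apply ℂ γ p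
  rw [hγ] at h1
  exact h1.symm

theorem theorem1p2 (m n : ℕ) (hm : 2 ≤ m) (hn : 2 ≤ n)
    (hirr : Irreducible (misiurewicz m n))
    (c₀ : ℂ) (hc₀ : aeval c₀ (misiurewicz m n) = 0) :
    (∃ x : NumberField.RingOfIntegers (IntermediateField.adjoin ℚ {c₀}),
      ((x : IntermediateField.adjoin ℚ {c₀}) : ℂ) = aeval c₀ (misiurewicz m 1) ∧
        ¬ IsUnit x) ∧
    (Even n →
      ∃ x : NumberField.RingOfIntegers (IntermediateField.adjoin ℚ {c₀}),
        ((x : IntermediateField.adjoin ℚ {c₀}) : ℂ) = aeval c₀ (misiurewicz m 2) ∧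
          ¬ IsUnit x) := by
  obtain ⟨l, rfl⟩ : ∃ l, m = l + 1 := ⟨m - 1, by omega⟩
  have hl : 1 ≤ l := by omega
  refine ⟨?_, fun h2n => ?_⟩
  · obtain ⟨x, hx⟩ := exists_ringOfIntegers_eq_misiurewicz (g := 1) hc₀
    refine ⟨x, hx, fun hu => not_isAlgUnit_misiurewicz_one hl hn hirr hc₀ ?_⟩
    rw [← hx]
    exact isAlgUnit_of_isUnit_ringOfIntegers hu
  · obtain ⟨x, hx⟩ := exists_ringOfIntegers_eq_misiurewicz (g := 2) hc₀
    refine ⟨x, hx, fun hu => not_isAlgUnit_misiurewicz_two hl hn hirr hc₀ h2n ?_⟩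
    rw [← hx]
    exact isAlgUnit_of_isUnit_ringOfIntegers hu
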